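/- Let $L>0$ and $Z\in\mathbb R$. Let $L^2_{per}$ be the space of complex $2L$-periodic functions that are square integrable on $[-L,L]$, let $H^1_{per}=H^1_{per}([0,2L])$ be the space of $u\in L^2_{per}$ whose derivative $u'$ in the sense of periodic distributions is in $L^2_{per}$, with norm $(\int_{-L}^{L}|u|^2+|u'|^2\,dx)^{1/2}$, and let $H^{-1}_{per}$ be its dual under the pairing that extends $(f,v)=\int_{-L}^{L} f\bar v\,dx$. Consider the cubic nonlinear Schrödinger equation with a periodic $\delta$-interaction, $$i\partial_t u+\partial_x^2u+Z\delta(x)u+|u|^2u=0,\qquad (1)$$ understood as an equation in $H^{-1}_{per}$, where $(\delta u,v)=u(0)\overline{v(0)}$ and $(\partial_x^2u,v)=-\int_{-L}^{L}u'\overline{v'}\,dx$ for $u,v\in H^1_{per}$. Put $$E(v)=\frac12\int_{-L}^{L}|v'|^2dx-\frac Z2|v(0)|^2-\frac14\int_{-L}^{L}|v|^4dx,\qquad Q(v)=\frac12\int_{-L}^{L}|v|^2dx .$$ For every $u_0\in H^1_{per}$ there is a solution $u\in C(\mathbb R;H^1_{per})\cap C^1(\mathbb R;H^{-1}_{per})$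 of (1) with $u(0)=u_0$. For every $T>0$, the restriction of $u$ to $[-T,T]$ is the only solution of (1) in $C([-T,T];H^1_{per})\cap C^1([-T,T];H^{-1}_{per})$ with value $u_0$ at $t=0$. For every $T_0>0$, the mapping $$u_0\in H^1_{per}\mapsto u\in C([-T_0,T_0];H^1_{per})$$ is continuous. The energy and the charge are conserved: $E(u(t))=E(u_0)$ and $Q(u(t))=Q(u_0)$ for all $t\in\mathbb R$. If $u_0$ is even, then $u(t)$ is even for every $t\in\mathbb R$. -/

import Mathlib

open MeasureTheory Set
open scoped ComplexConjugate ContDiff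

noncomputable section

namespace PeriodicNLS

instance factTwoMul (L : ℝ) [h : Fact (0 < L)] : Fact (0 < 2 * L) :=
  ⟨mul_pos two_pos h.out⟩

/-- The space `L²_per([0,2L])` of complex functions on the circle `ℝ / 2Lℤ`, which carries the
measure of total mass `2L`. -/
abbrev L2per (L : ℝ) [Fact (0 < L)] : Type :=
  Lp ℂ 2 (volume : Measure (AddCircle (2 * L)))

/-- `g` is the derivative of `f` in the sense of periodic distributions: the integration by parts
formula holds for all smooth `2L`-periodic test functions. -/
def IsWeakDeriv {L : ℝ} [Fact (0 < L)] (f g : L2per L) : Prop :=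
  ∀ φ : ℝ → ℂ, ContDiff ℝ ∞ φ → Function.Periodic φ (2 * L) →
    ∫ x in (-L)..L, f (x : AddCircle (2 * L)) * deriv φ x
      = -∫ x in (-L)..L, g (x : AddCircle (2 * L)) * φ x

section Integrals

variable {L : ℝ} [Fact (0 < L)]

theorem intervalIntegral_circle (F : AddCircle (2 * L) → ℂ) :
    ∫ x in (-L)..L, F (x : AddCircle (2 * L)) = ∫ y, F y := by
  have h := AddCircle.intervalIntegral_preimage (2 * L) (-L) F
  rwa [show -L + 2 * L = L by ring] at h

theorem integrable_L2per (f : L2per L) :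
    Integrable (f : AddCircle (2 * L) → ℂ) volume :=
  (Lp.memLp f).integrable (by norm_num)

theorem intervalIntegrable_mul (f : L2per L) {ψ : ℝ → ℂ} (hψ : Continuous ψ) :
    IntervalIntegrable (fun x : ℝ => f (x : AddCircle (2 * L)) * ψ x) volume (-L) L := by
  have hL : 0 < L := Fact.out
  have h1 : IntervalIntegrable (fun x : ℝ => f (x : AddCircle (2 * L))) volume (-L) L := by
    rw [intervalIntegrable_iff_integrableOn_Ioc_of_le (by linarith)]
    have hm := AddCircle.measurePreserving_mk (2 * L) (-L)
    rw [show -L + 2 * L = L by ring] at hm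
    exact hm.integrable_comp_of_integrable (integrable_L2per f)
  exact h1.mul_continuousOn hψ.continuousOn

theorem ae_coe {p : AddCircle (2 * L) → Prop} (h : ∀ᵐ y, p y) :
    ∀ᵐ x : ℝ, x ∈ uIoc (-L) L → p (x : AddCircle (2 * L)) := by
  have hL : 0 < L := Fact.out
  rw [uIoc_of_le (by linarith)]
  have hm := AddCircle.measurePreserving_mk (2 * L) (-L)
  rw [show -L + 2 * L = L by ring] at hm
  exact (ae_restrict_iff' measurableSet_Ioc).1 (hm.quasiMeasurePreserving.ae h)

theorem integral_add_mul (f g : L2per L) {ψ : ℝ → ℂ} (hψ : Continuous ψ) :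
    ∫ x in (-L)..L, (f + g : L2per L) (x : AddCircle (2 * L)) * ψ x
      = (∫ x in (-L)..L, f (x : AddCircle (2 * L)) * ψ x)
        + ∫ x in (-L)..L, g (x : AddCircle (2 * L)) * ψ x := by
  rw [← intervalIntegral.integral_add (intervalIntegrable_mul f hψ) (intervalIntegrable_mul g hψ)]
  refine intervalIntegral.integral_congr_ae ?_
  filter_upwards [ae_coe (Lp.coeFn_add f g)] with x hx hxI
  rw [hx hxI, Pi.add_apply, add_mul]

theorem integral_smul_mul (c : ℂ) (f : L2per L) (ψ : ℝ → ℂ) :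
    ∫ x in (-L)..L, (c • f : L2per L) (x : AddCircle (2 * L)) * ψ x
      = c * ∫ x in (-L)..L, f (x : AddCircle (2 * L)) * ψ x := by
  rw [← intervalIntegral.integral_const_mul]
  refine intervalIntegral.integral_congr_ae ?_
  filter_upwards [ae_coe (Lp.coeFn_smul c f)] with x hx hxI
  rw [hx hxI, Pi.smul_apply, smul_eq_mul, mul_assoc]

theorem integral_zero_mul (ψ : ℝ → ℂ) :
    ∫ x in (-L)..L, (0 : L2per L) (x : AddCircle (2 * L)) * ψ x = 0 := by
  have h := integral_smul_mul (0 : ℂ) (0 : L2per L) ψ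
  rwa [zero_smul, zero_mul] at h

end Integrals

/-- The pairs `(u, u')` in `L²_per × L²_per` such that `u'` is the weak derivative of `u`. -/
def h1Submodule (L : ℝ) [Fact (0 < L)] : Submodule ℂ (WithLp 2 (L2per L × L2per L)) where
  carrier := {p | IsWeakDeriv p.fst p.snd}
  add_mem' := by
    intro a b ha hb φ hφ hper
    have hd : Continuous (deriv φ) := hφ.continuous_deriv (by simp)
    change ∫ x in (-L)..L, (a.fst + b.fst : L2per L) (x : AddCircle (2 * L)) * deriv φ x
      = -∫ x in (-L)..L, (a.snd + b.snd : L2per L) (x : AddCircle (2 * L)) * φ x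
    rw [integral_add_mul _ _ hd, integral_add_mul _ _ hφ.continuous, ha φ hφ hper, hb φ hφ hper]
    ring
  zero_mem' := by
    intro φ hφ hper
    change ∫ x in (-L)..L, (0 : L2per L) (x : AddCircle (2 * L)) * deriv φ x
      = -∫ x in (-L)..L, (0 : L2per L) (x : AddCircle (2 * L)) * φ x
    rw [integral_zero_mul, integral_zero_mul, neg_zero]
  smul_mem' := by
    intro c a ha φ hφ hper
    change ∫ x in (-L)..L, (c • a.fst : L2per L) (x : AddCircle (2 * L)) * deriv φ x
      = -∫ x in (-L)..L, (c • a.snd : L2per L) (x : AddCircle (2 * L)) * φ x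
    rw [integral_smul_mul, integral_smul_mul, ha φ hφ hper]
    ring

/-- The Sobolev space `H¹_per([0,2L])`: the functions in `L²_per` whose weak derivative is in
`L²_per`, with the norm `(‖u‖² + ‖u'‖²)^(1/2)`. A function is stored together with its weak
derivative, which it determines. -/
def H1per (L : ℝ) [Fact (0 < L)] : Type := h1Submodule L

instance instNormedH1per (L : ℝ) [Fact (0 < L)] : NormedAddCommGroup (H1per L) :=
  inferInstanceAs (NormedAddCommGroup (h1Submodule L))

instance instInnerH1per (L : ℝ) [Fact (0 < L)] : InnerProductSpace ℂ (H1per L) :=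
  inferInstanceAs (InnerProductSpace ℂ (h1Submodule L))

section H1

variable {L : ℝ} [Fact (0 < L)]

/-- The inclusion of `H¹_per` in `L²_per`. -/
def toL2 : H1per L →L[ℂ] L2per L :=
  (WithLp.fstL 2 ℂ (L2per L) (L2per L)).comp (h1Submodule L).subtypeL

/-- The derivative `∂ₓ : H¹_per → L²_per`. -/
def dx : H1per L →L[ℂ] L2per L :=
  (WithLp.sndL 2 ℂ (L2per L) (L2per L)).comp (h1Submodule L).subtypeL

theorem isWeakDeriv_dx (u : H1per L) : IsWeakDeriv (toL2 u) (dx u) := Subtype.property u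

theorem norm_sq_H1per (u : H1per L) : ‖u‖ ^ 2 = ‖toL2 u‖ ^ 2 + ‖dx u‖ ^ 2 :=
  WithLp.prod_norm_sq_eq_of_L2 (Subtype.val u)

theorem fourierCoeff_dx (u : H1per L) (k : ℤ) :
    fourierCoeff (dx u : AddCircle (2 * L) → ℂ) k
      = (Complex.I * Real.pi * k / L) * fourierCoeff (toL2 u : AddCircle (2 * L) → ℂ) k := by
  have hL : (L : ℂ) ≠ 0 := by
    have : (0 : ℝ) < L := Fact.out
    exact_mod_cast this.ne'
  have hderiv : ∀ x : ℝ, HasDerivAt (fun y : ℝ => fourier (-k) (y : AddCircle (2 * L)))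
      (-(Complex.I * Real.pi * k / L) * fourier (-k) (x : AddCircle (2 * L))) x := by
    intro x
    convert! hasDerivAt_fourier_neg (2 * L) k x using 1
    push_cast
    field_simp
  have hsm : ContDiff ℝ ∞ (fun y : ℝ => fourier (-k) (y : AddCircle (2 * L))) := by
    simp_rw [fourier_coe_apply]
    have h0 : ContDiff ℝ ∞ (fun y : ℝ => (y : ℂ)) := Complex.ofRealCLM.contDiff
    exact ((contDiff_const.mul h0).div_const _).cexp
  have hper : Function.Periodic (fun y : ℝ => fourier (-k) (y : AddCircle (2 * L))) (2 * L) := by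
    intro x
    simp only [AddCircle.coe_add_period]
  have h := isWeakDeriv_dx u _ hsm hper
  rw [funext fun x => (hderiv x).deriv] at h
  have e : ∀ f : L2per L, fourierCoeff (f : AddCircle (2 * L) → ℂ) k
      = (1 / (2 * L) : ℝ) •
        ∫ x in (-L)..L, f (x : AddCircle (2 * L)) * fourier (-k) (x : AddCircle (2 * L)) := by
    intro f
    rw [fourierCoeff_eq_intervalIntegral _ k (-L), show -L + 2 * L = L by ring]
    simp only [smul_eq_mul, mul_comm]
  rw [e, e, ← neg_eq_iff_eq_neg.2 h]
  simp_rw [mul_left_comm _ (-(Complex.I * Real.pi * k / L))]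
  rw [intervalIntegral.integral_const_mul, neg_mul, neg_neg, mul_smul_comm]

theorem hasSum_sq_fourierCoeff_L2per (f : L2per L) :
    HasSum (fun k : ℤ => ‖fourierCoeff (f : AddCircle (2 * L) → ℂ) k‖ ^ 2)
      ((2 * L)⁻¹ * ‖f‖ ^ 2) := by
  have hm : MemLp (f : AddCircle (2 * L) → ℂ) 2 AddCircle.haarAddCircle := (Lp.memLp f).haarAddCircle
  have h := hasSum_sq_fourierCoeff hm.toLp
  have h2 : ∫ t : AddCircle (2 * L), ‖(hm.toLp _ : AddCircle (2 * L) → ℂ) t‖ ^ 2 ∂AddCircle.haarAddCircle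
      = (2 * L)⁻¹ * ‖f‖ ^ 2 := by
    have h3 : ∫ t : AddCircle (2 * L), ‖(hm.toLp _ : AddCircle (2 * L) → ℂ) t‖ ^ 2 ∂AddCircle.haarAddCircle
        = ∫ t : AddCircle (2 * L), ‖f t‖ ^ 2 ∂AddCircle.haarAddCircle := by
      refine integral_congr_ae ?_
      filter_upwards [hm.coeFn_toLp] with t ht
      rw [ht]
    rw [h3, AddCircle.integral_haarAddCircle, smul_eq_mul]
    congr 1
    have h4 := congrArg Complex.re (@L2.inner_def (AddCircle (2 * L)) ℂ ℂ _ _ _ _ _ f f)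
    have h5 : (∫ a, inner ℂ (f a) (f a)) = ((∫ a, ‖f a‖ ^ 2 : ℝ) : ℂ) := by
      rw [← integral_complex_ofReal]
      refine integral_congr_ae (Filter.Eventually.of_forall fun a => ?_)
      simp [inner_self_eq_norm_sq_to_K]
    rw [h5, inner_self_eq_norm_sq_to_K] at h4
    rw [← Complex.ofReal_re (∫ a, ‖f a‖ ^ 2), ← h4]
    norm_cast
  rw [h2] at h
  rwa [fourierCoeff_congr_ae hm.coeFn_toLp] at h

theorem exists_summable_weight (L : ℝ) : ∃ b : ℤ → ℝ, (∀ k, 0 ≤ b k) ∧ b 0 = 1 ∧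
    (∀ k, k ≠ 0 → b k = |L / (Real.pi * k)|) ∧ Summable fun k => b k ^ 2 := by
  refine ⟨fun k => if k = 0 then 1 else |L / (Real.pi * k)|, ?_, by simp, ?_, ?_⟩
  · intro k
    dsimp only
    split_ifs <;> positivity
  · intro k hk
    simp [hk]
  · have h1 : Summable fun k : ℤ => (L / Real.pi) ^ 2 * (1 / (k : ℝ) ^ 2) :=
      (Real.summable_one_div_int_pow.2 (by norm_num)).mul_left _
    have h2 : Summable fun k : ℤ => (Pi.single 0 1 : ℤ → ℝ) k :=
      (hasSum_pi_single (0 : ℤ) (1 : ℝ)).summable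
    refine (h1.add h2).congr fun k => ?_
    by_cases hk : k = 0
    · simp [hk]
    · simp only [hk, if_false, sq_abs, Pi.single_apply, add_zero]
      rw [div_pow, div_pow, mul_pow]
      field_simp

theorem fourierCoeff_bound : ∃ C : ℝ, ∀ u : H1per L,
    Summable (fun k : ℤ => ‖fourierCoeff (toL2 u : AddCircle (2 * L) → ℂ) k‖) ∧
    ∑' k : ℤ, ‖fourierCoeff (toL2 u : AddCircle (2 * L) → ℂ) k‖ ≤ C * ‖u‖ := by
  have hL : 0 < L := Fact.out
  obtain ⟨b, hb0, hb1, hbk, hbs⟩ := exists_summable_weight L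
  refine ⟨(∑' k, b k ^ 2) ^ (1 / 2 : ℝ) * ((2 * L)⁻¹) ^ (1 / 2 : ℝ), fun u => ?_⟩
  set c : ℤ → ℂ := fourierCoeff (toL2 u : AddCircle (2 * L) → ℂ) with hc
  set d : ℤ → ℂ := fourierCoeff (dx u : AddCircle (2 * L) → ℂ) with hd
  set e : ℤ → ℝ := fun k => √(‖c k‖ ^ 2 + ‖d k‖ ^ 2) with he
  have he2 : ∀ k, e k ^ 2 = ‖c k‖ ^ 2 + ‖d k‖ ^ 2 := fun k => Real.sq_sqrt (by positivity)
  have hes : HasSum (fun k => e k ^ 2) ((2 * L)⁻¹ * ‖u‖ ^ 2) := by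
    simp_rw [he2]
    rw [norm_sq_H1per, mul_add]
    exact (hasSum_sq_fourierCoeff_L2per (toL2 u)).add (hasSum_sq_fourierCoeff_L2per (dx u))
  have hle : ∀ k, ‖c k‖ ≤ b k * e k := by
    intro k
    by_cases hk : k = 0
    · rw [hk, hb1, one_mul]
      exact Real.le_sqrt_of_sq_le (by nlinarith [sq_nonneg ‖d 0‖])
    · have h1 : ‖c k‖ = b k * ‖d k‖ := by
        rw [hbk k hk, hd, fourierCoeff_dx u k, ← hc, norm_mul, ← mul_assoc]
        have hk' : (k : ℝ) ≠ 0 := by exact_mod_cast hk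
        have h2 : ‖Complex.I * Real.pi * k / L‖ = |Real.pi * k / L| := by
          rw [norm_div, norm_mul, norm_mul, Complex.norm_I, one_mul, abs_div, abs_mul]
          simp
        rw [h2, ← abs_mul]
        have h3 : L / (Real.pi * k) * (Real.pi * k / L) = 1 := by
          field_simp
        rw [h3, abs_one, one_mul]
      rw [h1]
      refine mul_le_mul_of_nonneg_left ?_ (hb0 k)
      exact Real.le_sqrt_of_sq_le (by nlinarith [sq_nonneg ‖c k‖])
  have he0 : ∀ k, 0 ≤ e k := fun k => Real.sqrt_nonneg _
  have hCS := Real.summable_and_inner_le_Lp_mul_Lq_tsum_of_nonneg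
    (Real.HolderConjugate.two_two) hb0 he0 (by simpa using hbs)
    (by simpa using hes.summable)
  have hs : Summable fun k => ‖c k‖ :=
    Summable.of_nonneg_of_le (fun k => norm_nonneg _) hle hCS.1
  refine ⟨hs, (hs.tsum_le_tsum hle hCS.1).trans (hCS.2.trans (le_of_eq ?_))⟩
  simp only [Real.rpow_ofNat]
  rw [hes.tsum_eq, Real.mul_rpow (by positivity) (by positivity), mul_assoc,
    ← Real.sqrt_eq_rpow (‖u‖ ^ 2), Real.sqrt_sq (norm_nonneg u)]

theorem ae_haar_iff {p : AddCircle (2 * L) → Prop} :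
    (∀ᵐ x ∂AddCircle.haarAddCircle, p x) ↔ ∀ᵐ x, p x := by
  have hL : 0 < 2 * L := Fact.out
  rw [AddCircle.volume_eq_smul_haarAddCircle, Measure.ae_ennreal_smul_measure_iff
    (by simpa using hL)]

theorem fourierCoeff_toL2_add (u v : H1per L) (k : ℤ) :
    fourierCoeff (toL2 (u + v) : AddCircle (2 * L) → ℂ) k
      = fourierCoeff (toL2 u : AddCircle (2 * L) → ℂ) k
        + fourierCoeff (toL2 v : AddCircle (2 * L) → ℂ) k := by
  have hi : ∀ f : L2per L, Integrable (f : AddCircle (2 * L) → ℂ) AddCircle.haarAddCircle :=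
    fun f => (Lp.memLp f).haarAddCircle.integrable (by norm_num)
  rw [map_add, ← Pi.add_apply, ← fourierCoeff.add (hi _) (hi _)]
  exact congrFun (fourierCoeff_congr_ae
    (ae_haar_iff.2 (Lp.coeFn_add (toL2 u) (toL2 v)))) k

theorem fourierCoeff_toL2_smul (a : ℂ) (u : H1per L) (k : ℤ) :
    fourierCoeff (toL2 (a • u) : AddCircle (2 * L) → ℂ) k
      = a * fourierCoeff (toL2 u : AddCircle (2 * L) → ℂ) k := by
  rw [map_smul]
  refine Eq.trans ?_ (fourierCoeff.const_smul _ a k)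
  exact congrFun (fourierCoeff_congr_ae
    (ae_haar_iff.2 (Lp.coeFn_smul a (toL2 u)))) k

theorem exists_toCont : ∃ R : H1per L →L[ℂ] C(AddCircle (2 * L), ℂ), ∀ u : H1per L,
    (R u : AddCircle (2 * L) → ℂ) =ᵐ[volume] (toL2 u : AddCircle (2 * L) → ℂ) := by
  obtain ⟨C, hC⟩ := fourierCoeff_bound (L := L)
  have hn : ∀ (u : H1per L) (k : ℤ),
      ‖fourierCoeff (toL2 u : AddCircle (2 * L) → ℂ) k • (fourier k : C(AddCircle (2 * L), ℂ))‖
        = ‖fourierCoeff (toL2 u : AddCircle (2 * L) → ℂ) k‖ := by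
    intro u k
    rw [norm_smul, fourier_norm, mul_one]
  have hs : ∀ u : H1per L, Summable fun k : ℤ =>
      fourierCoeff (toL2 u : AddCircle (2 * L) → ℂ) k •
        (fourier k : C(AddCircle (2 * L), ℂ)) := by
    intro u
    refine Summable.of_norm ?_
    simp_rw [hn]
    exact (hC u).1
  let R0 : H1per L →ₗ[ℂ] C(AddCircle (2 * L), ℂ) :=
    { toFun := fun u => ∑' k : ℤ, fourierCoeff (toL2 u : AddCircle (2 * L) → ℂ) k •
        (fourier k : C(AddCircle (2 * L), ℂ))
      map_add' := by
        intro u v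
        rw [← (hs u).tsum_add (hs v)]
        simp_rw [fourierCoeff_toL2_add, add_smul]
      map_smul' := by
        intro a u
        rw [RingHom.id_apply, ← (hs u).tsum_const_smul]
        simp_rw [fourierCoeff_toL2_smul, mul_smul] }
  refine ⟨R0.mkContinuous C fun u => ?_, fun u => ?_⟩
  · refine (norm_tsum_le_tsum_norm ?_).trans ?_
    · simp_rw [hn]
      exact (hC u).1
    · simp_rw [hn]
      exact (hC u).2
  · have hm : MemLp (toL2 u : AddCircle (2 * L) → ℂ) 2 AddCircle.haarAddCircle :=
      (Lp.memLp (toL2 u)).haarAddCircle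
    have h1 := hasSum_fourier_series_L2 hm.toLp
    rw [fourierCoeff_congr_ae hm.coeFn_toLp] at h1
    have h2 := (ContinuousMap.toLp (E := ℂ) 2
      (AddCircle.haarAddCircle : Measure (AddCircle (2 * L))) ℂ).hasSum (hs u).hasSum
    simp only [map_smul] at h2
    have h3 := h2.unique h1
    refine ae_haar_iff.1 ?_
    have h4 := ContinuousMap.coeFn_toLp (p := 2) (𝕜 := ℂ)
      (AddCircle.haarAddCircle : Measure (AddCircle (2 * L))) (R0 u)
    have h5 := hm.coeFn_toLp
    rw [← h3] at h5
    exact h4.symm.trans h5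

/-- The embedding of `H¹_per` in the continuous functions on the circle: `toCont u` is the
continuous function that agrees with `u` almost everywhere. -/
def toCont : H1per L →L[ℂ] C(AddCircle (2 * L), ℂ) := Classical.choose exists_toCont

theorem toCont_ae_eq (u : H1per L) :
    (toCont u : AddCircle (2 * L) → ℂ) =ᵐ[volume] (toL2 u : AddCircle (2 * L) → ℂ) :=
  Classical.choose_spec exists_toCont u

/-- The space `H⁻¹_per([0,2L])`, as the dual of `H¹_per([0,2L])`: the bounded functionals
`v ↦ (f, v)`, conjugate-linear in `v`, with the dual norm. -/
abbrev Hneg1per (L : ℝ) [Fact (0 < L)] : Type := H1per L →L⋆[ℂ] ℂ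

/-- The inclusion of `L²_per` in `H⁻¹_per`: `(f, v) = ∫ f v̄`. -/
def l2ToHneg1 (f : L2per L) : Hneg1per L := (innerSLFlip ℂ f).comp toL2

/-- The inclusion of `H¹_per` in `H⁻¹_per`: `(u, v) = ∫ u v̄`. -/
def toHneg1 (u : H1per L) : Hneg1per L := l2ToHneg1 (toL2 u)

/-- The second distributional derivative `∂ₓ² : H¹_per → H⁻¹_per`: `(∂ₓ² u, v) = -∫ u' v̄'`. -/
def dxx (u : H1per L) : Hneg1per L := -(innerSLFlip ℂ (dx u)).comp dx

/-- The product of `u ∈ H¹_per` with the Dirac distribution at the origin: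
`(δ u, v) = u(0) * conj v(0)`. -/
def diracMul (u : H1per L) : Hneg1per L :=
  (innerSLFlip ℂ (toCont u 0)).comp
    ((ContinuousMap.evalCLM ℂ (0 : AddCircle (2 * L))).comp toCont)

/-- The cubic nonlinearity `|u|² u`, a continuous function on the circle. -/
def cubic (u : H1per L) : C(AddCircle (2 * L), ℂ) :=
  ⟨fun x => (‖toCont u x‖ : ℂ) ^ 2 * toCont u x, by fun_prop⟩

/-- The cubic nonlinearity `|u|² u` as an element of `H⁻¹_per`. -/
def cubicHneg1 (u : H1per L) : Hneg1per L :=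
  l2ToHneg1 (ContinuousMap.toLp (E := ℂ) 2 volume ℂ (cubic u))

theorem l2ToHneg1_apply (f : L2per L) (v : H1per L) :
    l2ToHneg1 f v = (∫ x, f x * conj (toL2 v x)) := rfl

theorem dxx_apply (u v : H1per L) : dxx u v = -(∫ x, dx u x * conj (dx v x)) := rfl

theorem diracMul_apply (u v : H1per L) : diracMul u v = toCont u 0 * conj (toCont v 0) := rfl

/-- `u` is a solution of `i ∂ₜu + ∂ₓ²u + Z δ u + |u|² u = 0` on the time interval `I`, in the class
`C(I; H¹_per) ∩ C¹(I; H⁻¹_per)`; the equation holds in `H⁻¹_per` at every `t ∈ I`. The time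
derivative `w` is one-sided at the end points of `I` that belong to `I`. -/
def IsSolutionOn (Z : ℝ) (I : Set ℝ) (u : ℝ → H1per L) : Prop :=
  ContinuousOn u I ∧ ∃ w : ℝ → Hneg1per L, ContinuousOn w I ∧
    ∀ t ∈ I, HasDerivWithinAt (fun s => toHneg1 (u s)) (w t) I t ∧
      Complex.I • w t + dxx (u t) + (Z : ℂ) • diracMul (u t) + cubicHneg1 (u t) = 0

/-- The energy `E(u) = ½ ∫ |u'|² - (Z/2) |u(0)|² - ¼ ∫ |u|⁴`. -/
def energy (Z : ℝ) (u : H1per L) : ℝ :=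
  1 / 2 * (∫ x, ‖dx u x‖ ^ 2) - Z / 2 * ‖toCont u 0‖ ^ 2 - 1 / 4 * (∫ x, ‖toCont u x‖ ^ 4)

/-- The charge `Q(u) = ½ ∫ |u|²`. -/
def charge (u : H1per L) : ℝ := 1 / 2 * (∫ x, ‖toL2 u x‖ ^ 2)

/-- `u` is an even function: `u(-x) = u(x)`. -/
def IsEven (u : H1per L) : Prop := ∀ x : AddCircle (2 * L), toCont u (-x) = toCont u x

end H1

end PeriodicNLS

end

/-!
The Cauchy problem is solved in interaction variables. With `T = massOp` representing the `L²` inner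
product on `H¹_per` and `B = formOp Z l` representing the form of `-∂ₓ² + l - Z δ`, the Riesz
isomorphism of `H¹_per` with `H⁻¹_per` turns the equation into
`i ∂ₜ (T u) = B u - T (N u)`, where `N u = |u|² u + l u` (`nlin`) maps `H¹_per` to itself.

* *Linear group.* The Dirac term is a small form perturbation, so `B` is coercive for large `l`
  (`exists_formOp_coercive`). The group generated by `T⁻¹ B` is obtained without spectral measures:
  for an injective self-adjoint `A`, the function `x exp (-i t / x)` is continuous at `0`, and
  `S t (A f) = (x exp (-i t / x))(A) f` defines a unitary group on the dense range of `A`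
  (`exists_unitary_group`). Conjugation by `√B` gives the group `S` that preserves the form `B`
  (`exists_isFormGroup`).
* *Nonlinear equation.* For `w t = S (-t) (u t)` the equation is an ordinary differential equation in
  `H¹_per` with a locally Lipschitz right-hand side, because `H¹_per` is an algebra
  (`isWeakDeriv_mulL2`, by density of trigonometric polynomials). After radial truncation of the
  nonlinearity, the Picard-Lindelöf theorem gives global solutions (`exists_truncated_flow`).
* *Conservation laws.* Since `S` preserves `B`, the quadratic part of the energy is differentiable
  along `u = S w` although `u` is only differentiable in `H⁻¹_per`. The increments of the charge and
  of `∫ |u|⁴` are pairings of the increment of `u` with a factor that is continuous in `H¹_per`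
  (`hasDerivWithinAt_of_pairing`). So no regularization is needed (`hasDerivAt_energy`,
  `hasDerivAt_charge`).
* *Global existence.* The inequality `‖u‖_∞ ≤ ε ‖u‖_{H¹} + C_ε ‖u‖_{L²}` (`exists_norm_toCont_le`)
  bounds the `H¹` norm by energy and charge, so a suitable truncation is never active
  (`eq_and_lt_of_hasDerivAt_zero`, `exists_conservative_flow`).
* *Uniqueness, symmetry, continuity.* The difference of two solutions satisfies a Grönwall
  inequality in `L²` (`IsSolutionOn.eqOn`). The reflection of a solution is a solution, so even data
  stay even. Grönwall's inequality for `w` on bounded sets gives continuous dependence.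
-/

noncomputable section

namespace PeriodicNLS

/-! ### The unitary group generated by the inverse of an injective self-adjoint operator -/

/-- The function `x ↦ x exp (-i t / x)` of the real part of the argument, with value `0` at
`x = 0`, where it is continuous. -/
def phaseMul (t : ℝ) (z : ℂ) : ℂ := (z.re : ℂ) * Complex.exp ((-(t / z.re) : ℝ) * Complex.I)

theorem norm_phaseMul (t : ℝ) (z : ℂ) : ‖phaseMul t z‖ = |z.re| := by
  rw [phaseMul, norm_mul, Complex.norm_exp_ofReal_mul_I, mul_one, Complex.norm_real,
    Real.norm_eq_abs]

theorem continuous_phaseMul (t : ℝ) : Continuous (phaseMul t) := by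
  rw [continuous_iff_continuousAt]
  intro z
  by_cases hz : z.re = 0
  · have h0 : phaseMul t z = 0 := by simp [phaseMul, hz]
    rw [ContinuousAt, h0, tendsto_zero_iff_norm_tendsto_zero]
    simp_rw [norm_phaseMul]
    have : Continuous fun w : ℂ => |w.re| := by fun_prop
    simpa [hz] using this.tendsto z
  · unfold phaseMul
    have h1 : ContinuousAt (fun z : ℂ => -(t / z.re)) z :=
      (continuousAt_const.div Complex.continuous_re.continuousAt hz).neg
    have h2 : ContinuousAt (fun z : ℂ => ((-(t / z.re) : ℝ) : ℂ)) z :=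
      Complex.continuous_ofReal.continuousAt.comp h1
    exact (by fun_prop : ContinuousAt (fun z : ℂ => (z.re : ℂ)) z).mul
      ((h2.mul continuousAt_const).cexp)

theorem phaseMul_zero (z : ℂ) : phaseMul 0 z = z.re := by simp [phaseMul]

theorem phaseMul_mul (s t : ℝ) (z : ℂ) :
    phaseMul s z * phaseMul t z = z.re * phaseMul (s + t) z := by
  have h : ((-((s + t) / z.re) : ℝ) : ℂ) * Complex.I
      = ((-(s / z.re) : ℝ) : ℂ) * Complex.I + ((-(t / z.re) : ℝ) : ℂ) * Complex.I := by
    push_cast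
    ring
  simp only [phaseMul]
  rw [h, Complex.exp_add]
  ring

theorem norm_exp_mul_I_sub_one_sub_le (θ : ℝ) :
    ‖Complex.exp (θ * Complex.I) - 1 - θ * Complex.I‖ ≤ 3 * θ ^ 2 := by
  rcases le_or_gt |θ| 1 with h | h
  · have h1 : ‖(θ * Complex.I : ℂ)‖ ≤ 1 := by simpa using h
    have := Complex.norm_exp_sub_one_sub_id_le h1
    have h2 : ‖(θ * Complex.I : ℂ)‖ ^ 2 = θ ^ 2 := by simp
    nlinarith [sq_nonneg θ]
  · have h1 : ‖Complex.exp (θ * Complex.I) - 1 - θ * Complex.I‖ ≤ 1 + 1 + |θ| := by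
      refine (norm_sub_le _ _).trans (add_le_add ((norm_sub_le _ _).trans ?_) ?_)
      · simp [Complex.norm_exp_ofReal_mul_I]
      · simp
    have h2 : θ ^ 2 = |θ| ^ 2 := (sq_abs θ).symm
    nlinarith

theorem norm_phaseMul_sub_le (s t : ℝ) (z : ℂ) : ‖phaseMul s z - phaseMul t z‖ ≤ |s - t| := by
  by_cases hz : z.re = 0
  · simp [phaseMul, hz]
  have h : phaseMul s z - phaseMul t z
      = phaseMul t z * (Complex.exp (Complex.I * (-((s - t) / z.re) : ℝ)) - 1) := by
    simp only [phaseMul]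
    rw [mul_sub, mul_assoc, ← Complex.exp_add, mul_one]
    congr 3
    push_cast
    ring
  rw [h, norm_mul, norm_phaseMul]
  refine (mul_le_mul_of_nonneg_left (Real.norm_exp_I_mul_ofReal_sub_one_le) (abs_nonneg _)).trans ?_
  rw [Real.norm_eq_abs, abs_neg, abs_div]
  rw [mul_div_cancel₀ _ (abs_ne_zero.2 hz)]

theorem norm_re_mul_phaseMul_sub_le (s t : ℝ) (z : ℂ) :
    ‖z.re * (phaseMul s z - phaseMul t z) + (s - t) * Complex.I * phaseMul t z‖
      ≤ 3 * (s - t) ^ 2 := by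
  by_cases hz : z.re = 0
  · simp only [phaseMul, hz]
    simp
    positivity
  have hz' : (z.re : ℂ) ≠ 0 := by exact_mod_cast hz
  have h : z.re * (phaseMul s z - phaseMul t z) + (s - t) * Complex.I * phaseMul t z
      = z.re * phaseMul t z * (Complex.exp ((-((s - t) / z.re) : ℝ) * Complex.I) - 1
        - (-((s - t) / z.re) : ℝ) * Complex.I) := by
    have h1 : phaseMul s z
        = phaseMul t z * Complex.exp ((-((s - t) / z.re) : ℝ) * Complex.I) := by
      simp only [phaseMul]
      rw [mul_assoc, ← Complex.exp_add]
      congr 2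
      push_cast
      ring
    rw [h1]
    push_cast
    field_simp
    ring
  rw [h, norm_mul, norm_mul, norm_phaseMul, Complex.norm_real, Real.norm_eq_abs]
  refine (mul_le_mul_of_nonneg_left (norm_exp_mul_I_sub_one_sub_le _) (by positivity)).trans ?_
  rw [abs_mul_abs_self]
  apply le_of_eq
  field_simp

section Group

variable {K : Type*} [NormedAddCommGroup K] [InnerProductSpace ℂ K] [CompleteSpace K]

omit [CompleteSpace K] in
theorem inner_self_eq_ofReal (x : K) : inner ℂ x x = ((‖x‖ ^ 2 : ℝ) : ℂ) := by
  rw [inner_self_eq_norm_sq_to_K]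
  push_cast
  rfl

theorem cfc_re_mul {T : K →L[ℂ] K} (hT : IsSelfAdjoint T) {f : ℂ → ℂ} (hf : Continuous f) :
    cfc (fun z : ℂ => (z.re : ℂ) * f z) T = T * cfc f T := by
  have hn : IsStarNormal T := hT.isStarNormal
  rw [cfc_mul (fun z : ℂ => (z.re : ℂ)) f T (by fun_prop) hf.continuousOn]
  congr 1
  rw [cfc_congr (g := id) fun z hz => (hT.mem_spectrum_eq_re hz).symm, cfc_id ℂ T]

theorem cfc_phaseMul_zero {T : K →L[ℂ] K} (hT : IsSelfAdjoint T) : cfc (phaseMul 0) T = T := by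
  have hn : IsStarNormal T := hT.isStarNormal
  rw [cfc_congr (g := id) fun z hz => by
    rw [phaseMul_zero]; exact (hT.mem_spectrum_eq_re hz).symm, cfc_id ℂ T]

theorem cfc_phaseMul_mul {T : K →L[ℂ] K} (hT : IsSelfAdjoint T) (s t : ℝ) :
    cfc (phaseMul s) T * cfc (phaseMul t) T = T * cfc (phaseMul (s + t)) T := by
  have hn : IsStarNormal T := hT.isStarNormal
  rw [← cfc_mul _ _ T (continuous_phaseMul s).continuousOn (continuous_phaseMul t).continuousOn,
    ← cfc_re_mul hT (continuous_phaseMul _)]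
  exact congrArg (fun f => cfc f T) (funext fun z => phaseMul_mul s t z)

theorem cfc_phaseMul_comm {T : K →L[ℂ] K} (hT : IsSelfAdjoint T) (t : ℝ) :
    cfc (phaseMul t) T * T = T * cfc (phaseMul t) T := by
  have h := cfc_phaseMul_mul hT t 0
  rwa [cfc_phaseMul_zero hT, add_zero] at h

theorem norm_cfc_phaseMul_apply {T : K →L[ℂ] K} (hT : IsSelfAdjoint T) (t : ℝ) (x : K) :
    ‖cfc (phaseMul t) T x‖ = ‖T x‖ := by
  have hn : IsStarNormal T := hT.isStarNormal
  have h : star (cfc (phaseMul t) T) * cfc (phaseMul t) T = star T * T := by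
    rw [← cfc_star, ← cfc_mul _ _ T (continuous_phaseMul t).star.continuousOn
      (continuous_phaseMul t).continuousOn, hT.star_eq]
    have h0 : cfc (fun z : ℂ => (z.re : ℂ) * phaseMul 0 z) T = T * T := by
      rw [cfc_re_mul hT (continuous_phaseMul 0), cfc_phaseMul_zero hT]
    rw [← h0]
    refine congrArg (fun f => cfc f T) (funext fun z => ?_)
    rw [phaseMul_zero]
    have := Complex.conj_mul' (phaseMul t z)
    rw [norm_phaseMul] at this
    rw [Complex.star_def, this]
    norm_cast
    rw [sq_abs, sq]
  rw [← sq_eq_sq₀ (norm_nonneg _) (norm_nonneg _),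
    ContinuousLinearMap.apply_norm_sq_eq_inner_adjoint_left,
    ContinuousLinearMap.apply_norm_sq_eq_inner_adjoint_left]
  have := congrArg (fun A : K →L[ℂ] K => inner ℂ (A x) x) h
  simp only [ContinuousLinearMap.star_eq_adjoint, mul_apply_eq_comp] at this
  simp only [ContinuousLinearMap.comp_apply]
  rw [this]

theorem norm_cfc_phaseMul_sub_le {T : K →L[ℂ] K} (hT : IsSelfAdjoint T) (s t : ℝ) :
    ‖cfc (phaseMul s) T - cfc (phaseMul t) T‖ ≤ |s - t| := by
  have hn : IsStarNormal T := hT.isStarNormal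
  rw [← cfc_sub _ _ T (continuous_phaseMul s).continuousOn (continuous_phaseMul t).continuousOn]
  exact norm_cfc_le (abs_nonneg _) fun z _ => norm_phaseMul_sub_le s t z

theorem norm_mul_cfc_phaseMul_sub_le {T : K →L[ℂ] K} (hT : IsSelfAdjoint T) (s t : ℝ) :
    ‖T * (cfc (phaseMul s) T - cfc (phaseMul t) T)
      + ((s - t) * Complex.I : ℂ) • cfc (phaseMul t) T‖ ≤ 3 * (s - t) ^ 2 := by
  have hn : IsStarNormal T := hT.isStarNormal
  have hs := continuous_phaseMul s
  have ht := continuous_phaseMul t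
  rw [← cfc_sub _ _ T hs.continuousOn ht.continuousOn,
    ← cfc_re_mul hT (by fun_prop : Continuous fun z => phaseMul s z - phaseMul t z),
    ← cfc_const_mul _ _ T ht.continuousOn, ← cfc_add _ _ _
      (by fun_prop) (by fun_prop)]
  exact norm_cfc_le (by positivity) fun z _ => norm_re_mul_phaseMul_sub_le s t z

theorem denseRange_of_isSelfAdjoint {T : K →L[ℂ] K} (hT : IsSelfAdjoint T)
    (hinj : Function.Injective T) : DenseRange T := by
  have h : (LinearMap.range T.toLinearMap)ᗮ = ⊥ := by
    have h1 := ContinuousLinearMap.orthogonal_range T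
    rw [hT.adjoint_eq] at h1
    rw [h1]
    exact LinearMap.ker_eq_bot.2 hinj
  have h2 := (Submodule.topologicalClosure_eq_top_iff).2 h
  rw [DenseRange, dense_iff_closure_eq]
  have h3 := congrArg (fun S : Submodule ℂ K => (S : Set K)) h2
  rw [Submodule.topologicalClosure_coe] at h3
  exact h3

/-- An injective self-adjoint bounded operator `T` is the inverse of a self-adjoint operator, which
generates the unitary group `S t = exp (-i t T⁻¹)`. On the range of `T` it is given by
`S t (T f) = g_t(T) f` with the bounded continuous function `g_t(x) = x exp (-i t / x)`. -/
theorem exists_unitary_group {T : K →L[ℂ] K} (hT : IsSelfAdjoint T)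
    (hinj : Function.Injective T) : ∃ S : ℝ → K →L[ℂ] K, S 0 = 1 ∧
      (∀ s t, S s * S t = S (s + t)) ∧ (∀ t x, ‖S t x‖ = ‖x‖) ∧
      (∀ x, Continuous fun t => S t x) ∧
      ∀ t x, HasDerivAt (fun r => T (S r x)) (-Complex.I • S t x) t := by
  have hd : DenseRange T := denseRange_of_isSelfAdjoint hT hinj
  set G : ℝ → K →L[ℂ] K := fun t => cfc (phaseMul t) T with hG
  have hGn : ∀ t x, ‖G t x‖ = ‖T x‖ := norm_cfc_phaseMul_apply hT
  let S : ℝ → K →L[ℂ] K := fun t => (G t).toLinearMap.extendOfNorm T.toLinearMap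
  have hST : ∀ t x, S t (T x) = G t x := fun t x =>
    LinearMap.extendOfNorm_eq (f := (G t).toLinearMap) (e := T.toLinearMap) hd
      ⟨1, fun x => by rw [one_mul]; exact (hGn t x).le⟩ x
  have hSn : ∀ t x, ‖S t x‖ = ‖x‖ := by
    intro t x
    refine hd.induction_on (p := fun x => ‖S t x‖ = ‖x‖) x
      (isClosed_eq (by fun_prop) (by fun_prop)) fun y => ?_
    rw [hST, hGn]
  have hTS : ∀ t x, T (S t x) = G t x := by
    intro t x
    refine hd.induction_on (p := fun x => T (S t x) = G t x) x
      (isClosed_eq (by fun_prop) (by fun_prop)) fun y => ?_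
    rw [hST]
    exact (congrArg (fun A : K →L[ℂ] K => A y) (cfc_phaseMul_comm hT t)).symm
  have hlip : ∀ s t x, ‖G s x - G t x‖ ≤ |s - t| * ‖x‖ := by
    intro s t x
    exact (ContinuousLinearMap.le_opNorm (G s - G t) x).trans
      (mul_le_mul_of_nonneg_right (norm_cfc_phaseMul_sub_le hT s t) (norm_nonneg x))
  refine ⟨S, ?_, ?_, hSn, ?_, ?_⟩
  · ext x
    refine hd.induction_on (p := fun x => S 0 x = (1 : K →L[ℂ] K) x) x
      (isClosed_eq (by fun_prop) (by fun_prop)) fun y => ?_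
    rw [hST]
    exact congrArg (fun A : K →L[ℂ] K => A y) (cfc_phaseMul_zero hT)
  · intro s t
    ext x
    refine hd.induction_on (p := fun x => (S s * S t) x = S (s + t) x) x
      (isClosed_eq (by fun_prop) (by fun_prop)) fun y => ?_
    apply hinj
    rw [mul_apply_eq_comp, hTS, hST, hST]
    exact congrArg (fun A : K →L[ℂ] K => A y) (cfc_phaseMul_mul hT s t)
  · intro x
    rw [Metric.continuous_iff]
    intro t ε hε
    obtain ⟨y, hy⟩ := Metric.denseRange_iff.1 hd x (ε / 4) (by positivity)
    refine ⟨ε / (4 * (‖y‖ + 1)), by positivity, fun s hs => ?_⟩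
    rw [Real.dist_eq, lt_div_iff₀ (by positivity)] at hs
    rw [dist_eq_norm] at hy ⊢
    have h1 : S s x - S t x = S s (x - T y) - S t (x - T y) + (G s y - G t y) := by
      rw [map_sub, map_sub, hST, hST]
      abel
    have h2 := norm_add_le (S s (x - T y) - S t (x - T y)) (G s y - G t y)
    have h3 := norm_sub_le (S s (x - T y)) (S t (x - T y))
    rw [hSn, hSn] at h3
    have h4 := hlip s t y
    rw [h1]
    nlinarith [abs_nonneg (s - t), norm_nonneg y]
  · intro t x
    have hTS' : (fun r => T (S r x)) = fun r => G r x := funext fun r => hTS r x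
    rw [hTS', hasDerivAt_iff_isLittleO, Asymptotics.isLittleO_iff]
    intro ε hε
    obtain ⟨y, hy⟩ := Metric.denseRange_iff.1 hd x (ε / 4) (by positivity)
    have hball : Metric.ball t (ε / (8 * (‖y‖ + 1))) ∈ nhds t :=
      Metric.ball_mem_nhds t (by positivity)
    filter_upwards [hball] with s hs
    rw [Metric.mem_ball, Real.dist_eq, lt_div_iff₀ (by positivity)] at hs
    rw [dist_eq_norm] at hy
    -- The quadratic remainder on `T y` and two Lipschitz errors on `x - T y`.
    have h1 : G s x - G t x - (s - t) • (-Complex.I • S t x)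
        = (G s (x - T y) - G t (x - T y)) + ((s - t : ℝ) : ℂ) • Complex.I • S t (x - T y)
          + (T * (G s - G t) + (((s : ℂ) - t) * Complex.I) • G t) y := by
      have hc : ∀ r, G r (T y) = T (G r y) := fun r =>
        congrArg (fun A : K →L[ℂ] K => A y) (cfc_phaseMul_comm hT r)
      simp only [map_sub, hc, hST, add_apply, mul_apply_eq_comp,
        sub_apply, smul_apply, smul_sub, mul_smul, sub_smul,
        neg_smul, smul_neg, Complex.ofReal_sub, sub_mul, RCLike.real_smul_eq_coe_smul (K := ℂ),
        Complex.coe_algebraMap]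
      simp only [Complex.coe_smul]
      module
    have h2 := hlip s t (x - T y)
    have h3 : ‖((s - t : ℝ) : ℂ) • Complex.I • S t (x - T y)‖ = |s - t| * ‖x - T y‖ := by
      rw [norm_smul, norm_smul, hSn, Complex.norm_I, one_mul, Complex.norm_real, Real.norm_eq_abs]
    have h4 : ‖(T * (G s - G t) + (((s : ℂ) - t) * Complex.I) • G t) y‖
        ≤ 3 * (s - t) ^ 2 * ‖y‖ :=
      (ContinuousLinearMap.le_opNorm _ y).trans
        (mul_le_mul_of_nonneg_right (norm_mul_cfc_phaseMul_sub_le hT s t) (norm_nonneg y))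
    rw [h1]
    refine (norm_add₃_le).trans ?_
    rw [h3, Real.norm_eq_abs, ← sq_abs (s - t)] at *
    have h5 : |s - t| * (|s - t| * (8 * (‖y‖ + 1))) ≤ |s - t| * ε :=
      mul_le_mul_of_nonneg_left hs.le (abs_nonneg _)
    have h6 : |s - t| * ‖x - T y‖ ≤ |s - t| * (ε / 4) :=
      mul_le_mul_of_nonneg_left hy.le (abs_nonneg _)
    nlinarith [abs_nonneg (s - t), norm_nonneg y, mul_nonneg (abs_nonneg (s-t)) (abs_nonneg (s-t)),
      mul_nonneg (abs_nonneg (s-t)) hε.le]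

/-- `S` is the linear Schrödinger group in the form sense: if `⟪T x, y⟫` is the pivot inner product
and `⟪B x, y⟫` a form, then `u = S t x` solves `i ∂ₜ (T u) = B u`, and `S` preserves the form. -/
structure IsFormGroup (T B : K →L[ℂ] K) (S : ℝ → K →L[ℂ] K) : Prop where
  zero : S 0 = 1
  mul : ∀ s t, S s * S t = S (s + t)
  inner_form : ∀ t x y, inner ℂ (B (S t x)) (S t y) = inner ℂ (B x) y
  bounded : ∃ M, ∀ t, ‖S t‖ ≤ M
  cont : ∀ x, Continuous fun t => S t x
  deriv : ∀ t x, HasDerivAt (fun r => T (S r x)) (-Complex.I • B (S t x)) t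

/-- A coercive form generates a group: it is the conjugate by `√B` of the unitary group generated
by the inverse of `√B⁻¹ T √B⁻¹`. -/
theorem exists_isFormGroup {T B : K →L[ℂ] K} (hT : IsSelfAdjoint T)
    (hinj : Function.Injective T) (hB : IsSelfAdjoint B) {c : ℝ} (hc : 0 < c)
    (hco : ∀ x, c * ‖x‖ ^ 2 ≤ (inner ℂ (B x) x).re) :
    ∃ S : ℝ → K →L[ℂ] K, IsFormGroup T B S := by
  have hBpos : (algebraMap ℝ (K →L[ℂ] K) c) ≤ B := by
    rw [ContinuousLinearMap.le_def]
    refine ⟨?_, fun x => ?_⟩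
    · have : IsSelfAdjoint (B - algebraMap ℝ (K →L[ℂ] K) c) := hB.sub (.algebraMap _ (.all c))
      exact ContinuousLinearMap.isSelfAdjoint_iff_isSymmetric.1 this
    · have h := hco x
      rw [ContinuousLinearMap.reApplyInnerSelf_apply]
      have h2 : (B - algebraMap ℝ (K →L[ℂ] K) c) x = B x - (c : ℂ) • x := by
        simp [Algebra.algebraMap_eq_smul_one]
      rw [h2, inner_sub_left, inner_smul_left, inner_self_eq_ofReal, Complex.conj_ofReal,
        ← Complex.ofReal_mul, RCLike.re_eq_complex_re, Complex.sub_re, Complex.ofReal_re]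
      linarith
  have hcpos : IsStrictlyPositive (algebraMap ℝ (K →L[ℂ] K) c) := by
    refine IsStrictlyPositive.iff_of_unital.2 ⟨?_, ?_⟩
    · exact algebraMap_nonneg _ hc.le
    · exact (isUnit_iff_ne_zero.2 hc.ne').map _
  have hBu : IsUnit B := CStarAlgebra.isUnit_of_le _ hBpos hcpos
  have hB0 : 0 ≤ B := hcpos.nonneg.trans hBpos
  obtain ⟨C, hC⟩ := (CFC.isUnit_sqrt_iff B).2 hBu
  have hCC : (C : K →L[ℂ] K) * C = B := by rw [hC]; exact CFC.sqrt_mul_sqrt_self B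
  have hCs : IsSelfAdjoint (C : K →L[ℂ] K) := by rw [hC]; exact (CFC.sqrt_nonneg B).isSelfAdjoint
  set D : K →L[ℂ] K := ((C⁻¹ : (K →L[ℂ] K)ˣ) : K →L[ℂ] K) with hD
  have hDs : IsSelfAdjoint D := by
    have h1 : star C = C := Units.ext hCs
    have h2 : star (C⁻¹) = C⁻¹ := by rw [star_inv, h1]
    exact congrArg Units.val h2
  have hCD : ∀ x, (C : K →L[ℂ] K) (D x) = x := fun x =>
    congrArg (fun A : K →L[ℂ] K => A x) (C.mul_inv)
  have hDC : ∀ x, D ((C : K →L[ℂ] K) x) = x := fun x =>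
    congrArg (fun A : K →L[ℂ] K => A x) (C.inv_mul)
  have hT' : IsSelfAdjoint (D * T * D) := by
    have := hT.conjugate D
    rwa [hDs.star_eq] at this
  have hinj' : Function.Injective (D * T * D) := by
    have hDi : Function.Injective D := Function.LeftInverse.injective hCD
    exact hDi.comp (hinj.comp hDi)
  obtain ⟨U, hU0, hUm, hUn, hUc, hUd⟩ := exists_unitary_group hT' hinj'
  have hBi : ∀ x y, inner ℂ (B x) y = inner ℂ ((C : K →L[ℂ] K) x) ((C : K →L[ℂ] K) y) := by
    intro x y
    rw [← hCC, mul_apply_eq_comp]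
    exact (ContinuousLinearMap.isSelfAdjoint_iff_isSymmetric.1 hCs) _ _
  have hUi : ∀ t x y, inner ℂ (U t x) (U t y) = inner ℂ x y := by
    intro t
    exact (LinearIsometry.mk (U t).toLinearMap (hUn t)).inner_map_map
  refine ⟨fun t => D * U t * C, ?_, ?_, ?_, ⟨‖D‖ * 1 * ‖(C : K →L[ℂ] K)‖, fun t => ?_⟩, ?_, ?_⟩
  · ext x
    simp [hU0, hDC]
  · intro s t
    ext x
    simp [hCD, ← hUm]
  · intro t x y
    rw [hBi, hBi]
    simp [hCD, hUi]
  · refine (norm_mul_le _ _).trans (mul_le_mul_of_nonneg_right ?_ (norm_nonneg _))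
    refine (norm_mul_le _ _).trans (mul_le_mul_of_nonneg_left ?_ (norm_nonneg _))
    exact ContinuousLinearMap.opNorm_le_bound _ zero_le_one fun x => by rw [hUn, one_mul]
  · intro x
    exact D.continuous.comp (hUc _)
  · intro t x
    have h := ((C : K →L[ℂ] K).restrictScalars ℝ).hasFDerivAt.comp_hasDerivAt t
      (hUd t ((C : K →L[ℂ] K) x))
    refine (h.congr_deriv ?_).congr_of_eventuallyEq (Filter.Eventually.of_forall fun r => ?_)
    · rw [← hCC]
      simp [hCD]
    · simp [hCD]

end Group

/-! ### Ordinary differential equations with bounded Lipschitz right-hand side -/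

section ODE

variable {E : Type*} [NormedAddCommGroup E] [NormedSpace ℝ E]

/-- Grönwall's inequality in both time directions, for trajectories that stay in the sets on which
the vector field is Lipschitz. -/
theorem dist_le_of_hasDerivAt_of_lipschitzOnWith {f : ℝ → E → E} {s : ℝ → Set E} {C : NNReal}
    (hf : ∀ t, LipschitzOnWith C (f t) (s t)) {v w : ℝ → E}
    (hv : ∀ t, HasDerivAt v (f t (v t)) t) (hvs : ∀ t, v t ∈ s t)
    (hw : ∀ t, HasDerivAt w (f t (w t)) t) (hws : ∀ t, w t ∈ s t) (t : ℝ) :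
    dist (v t) (w t) ≤ dist (v 0) (w 0) * Real.exp (C * |t|) := by
  rcases le_total 0 t with ht | ht
  · have h := dist_le_of_trajectories_ODE_of_mem (a := 0) (b := t) (fun r _ => hf r)
      (fun r _ => (hv r).continuousAt.continuousWithinAt)
      (fun r _ => (hv r).hasDerivWithinAt) (fun r _ => hvs r)
      (fun r _ => (hw r).continuousAt.continuousWithinAt)
      (fun r _ => (hw r).hasDerivWithinAt) (fun r _ => hws r) le_rfl t ⟨ht, le_rfl⟩
    rw [sub_zero] at h
    rwa [abs_of_nonneg ht]
  · have hr : ∀ {v : ℝ → E}, (∀ t, HasDerivAt v (f t (v t)) t) →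
        ∀ r, HasDerivAt (fun r => v (-r)) (-f (-r) (v (-r))) r := by
      intro v hv r
      have := (hv (-r)).scomp r (hasDerivAt_neg r)
      simpa [Function.comp_def] using this
    have h := dist_le_of_trajectories_ODE_of_mem (v := fun r x => -f (-r) x) (K := C)
      (s := fun r => s (-r)) (f := fun r => v (-r)) (g := fun r => w (-r)) (a := 0) (b := -t)
      (δ := dist (v 0) (w 0)) (fun r _ => (hf (-r)).neg)
      (fun r _ => (hr hv r).continuousAt.continuousWithinAt)
      (fun r _ => (hr hv r).hasDerivWithinAt) (fun r _ => hvs (-r))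
      (fun r _ => (hr hw r).continuousAt.continuousWithinAt)
      (fun r _ => (hr hw r).hasDerivWithinAt) (fun r _ => hws (-r)) (by simp) (-t)
      ⟨by linarith, le_rfl⟩
    rw [sub_zero, neg_neg] at h
    rwa [abs_of_nonpos ht]

/-- A bounded, globally Lipschitz vector field has global integral curves: on `[-n, n]` the
Picard-Lindelöf theorem applies in a ball of radius `n * sup ‖f‖`, without restriction on `n`. -/
theorem exists_forall_hasDerivAt_of_lipschitz_of_bounded [CompleteSpace E] {f : ℝ → E → E}
    {C b : NNReal} (hf : ∀ t, LipschitzWith C (f t)) (hc : ∀ x, Continuous fun t => f t x)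
    (hb : ∀ t x, ‖f t x‖ ≤ b) (x₀ : E) :
    ∃ w : ℝ → E, w 0 = x₀ ∧ ∀ t, HasDerivAt w (f t (w t)) t := by
  have hex : ∀ n : ℕ, ∃ w : ℝ → E, w 0 = x₀ ∧
      ∀ t ∈ Ioo (-(n + 1) : ℝ) (n + 1), HasDerivAt w (f t (w t)) t := by
    intro n
    have h0 : (0 : ℝ) ∈ Icc (-(n + 1) : ℝ) (n + 1) := ⟨by linarith [n.cast_nonneg (α := ℝ)],
      by positivity⟩
    have hp : IsPicardLindelof f (tmin := -(n + 1)) (tmax := n + 1) ⟨0, h0⟩ x₀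
        (b * (n + 1)) 0 b C :=
      { lipschitzOnWith := fun t _ => (hf t).lipschitzOnWith
        continuousOn := fun x _ => (hc x).continuousOn
        norm_le := fun t _ x _ => hb t x
        mul_max_le := by
          push_cast
          rw [sub_zero, zero_sub, neg_neg, max_self, sub_zero] }
    obtain ⟨w, hw0, hw⟩ := hp.exists_eq_forall_mem_Icc_hasDerivWithinAt₀
    exact ⟨w, hw0, fun t ht => (hw t (Ioo_subset_Icc_self ht)).hasDerivAt (Icc_mem_nhds ht.1 ht.2)⟩
  choose w hw0 hw using hex
  have hmono : ∀ m n : ℕ, m ≤ n → EqOn (w m) (w n) (Ioo (-(m + 1) : ℝ) (m + 1)) := by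
    intro m n hmn
    have hmn' : (m : ℝ) ≤ n := by exact_mod_cast hmn
    have h0 : (0 : ℝ) ∈ Ioo (-(m + 1) : ℝ) (m + 1) :=
      ⟨by linarith [m.cast_nonneg (α := ℝ)], by positivity⟩
    refine ODE_solution_unique_of_mem_Ioo (v := f) (s := fun _ => univ) (K := C)
      (fun t _ => (hf t).lipschitzOnWith) h0 (fun t ht => ⟨hw m t ht, trivial⟩)
      (fun t ht => ⟨hw n t ⟨by linarith [ht.1], by linarith [ht.2]⟩, trivial⟩) ?_
    rw [hw0, hw0]
  have hab : ∀ t : ℝ, ∀ m n : ℕ, |t| < m + 1 → |t| < n + 1 → w m t = w n t := by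
    intro t m n hm hn
    rcases le_total m n with h | h
    · exact hmono m n h (abs_lt.1 hm)
    · exact (hmono n m h (abs_lt.1 hn)).symm
  refine ⟨fun t => w ⌊|t|⌋₊ t, hw0 _, fun t => ?_⟩
  obtain ⟨n, hn⟩ := exists_nat_gt |t|
  have hn' : |t| < n + 1 := hn.trans (lt_add_one _)
  have hev : (fun t => w ⌊|t|⌋₊ t) =ᶠ[nhds t] w n := by
    filter_upwards [(continuous_abs.tendsto t).eventually_lt_const hn'] with s hs
    exact hab s _ _ (Nat.lt_floor_add_one _) hs
  have h := (hw n t (abs_lt.1 hn')).congr_of_eventuallyEq hev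
  rwa [← hev.eq_of_nhds] at h

/-- The retraction of a normed space onto the closed ball of radius `R` along rays. -/
def radial (R : ℝ) (x : E) : E := (R / max R ‖x‖) • x

theorem radial_of_norm_le {R : ℝ} (hR : 0 < R) {x : E} (hx : ‖x‖ ≤ R) : radial R x = x := by
  rw [radial, max_eq_left hx, div_self hR.ne', one_smul]

theorem norm_radial_le {R : ℝ} (hR : 0 < R) (x : E) : ‖radial R x‖ ≤ R := by
  have hm : 0 < max R ‖x‖ := lt_max_of_lt_left hR
  rw [radial, norm_smul, Real.norm_of_nonneg (by positivity), div_mul_eq_mul_div,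
    div_le_iff₀ hm]
  exact mul_le_mul_of_nonneg_left (le_max_right _ _) hR.le

theorem norm_radial_sub_le {R : ℝ} (hR : 0 < R) (x y : E) :
    ‖radial R x - radial R y‖ ≤ 2 * ‖x - y‖ := by
  have hx : 0 < max R ‖x‖ := lt_max_of_lt_left hR
  have hy : 0 < max R ‖y‖ := lt_max_of_lt_left hR
  have h : radial R x - radial R y
      = (R / max R ‖x‖) • (x - y) + (R / max R ‖x‖ - R / max R ‖y‖) • y := by
    simp only [radial]
    module
  have h1 : ‖(R / max R ‖x‖) • (x - y)‖ ≤ ‖x - y‖ := by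
    rw [norm_smul, Real.norm_of_nonneg (by positivity)]
    refine mul_le_of_le_one_left (norm_nonneg _) ?_
    rw [div_le_one hx]
    exact le_max_left _ _
  have h2 : ‖(R / max R ‖x‖ - R / max R ‖y‖) • y‖ ≤ ‖x - y‖ := by
    have h3 : R / max R ‖x‖ - R / max R ‖y‖
        = (R / max R ‖x‖) * ((max R ‖y‖ - max R ‖x‖) / max R ‖y‖) := by
      field_simp
    have h4 : |max R ‖y‖ - max R ‖x‖| ≤ ‖x - y‖ := by
      refine (abs_max_sub_max_le_max _ _ _ _).trans ?_
      rw [sub_self, abs_zero, norm_sub_rev, max_eq_right (abs_nonneg _)]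
      exact abs_norm_sub_norm_le y x
    rw [norm_smul, h3, norm_mul, Real.norm_of_nonneg (by positivity : 0 ≤ R / max R ‖x‖),
      Real.norm_eq_abs, abs_div, abs_of_pos hy, mul_assoc,
      div_mul_eq_mul_div (|max R ‖y‖ - max R ‖x‖|)]
    have h5 : R / max R ‖x‖ ≤ 1 := (div_le_one hx).2 (le_max_left _ _)
    have h6 : |max R ‖y‖ - max R ‖x‖| * ‖y‖ / max R ‖y‖ ≤ ‖x - y‖ := by
      rw [div_le_iff₀ hy]
      exact mul_le_mul h4 (le_max_right _ _) (norm_nonneg _) (norm_nonneg _)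
    calc _ ≤ 1 * ‖x - y‖ := mul_le_mul h5 h6 (by positivity) zero_le_one
      _ = _ := one_mul _
  rw [h]
  linarith [norm_add_le ((R / max R ‖x‖) • (x - y)) ((R / max R ‖x‖ - R / max R ‖y‖) • y)]

/-- A continuation principle: a quantity `e` that is stationary while `f ≤ R` and whose value at
time `0` forces `f < R` is conserved for all times. The set where `e` has its initial value is open
and closed. -/
theorem eq_and_lt_of_hasDerivAt_zero {f : ℝ → ℝ} {e : ℝ → E} {R : ℝ} (hf : Continuous f)
    (he : Continuous e) (h1 : ∀ t, f t ≤ R → HasDerivAt e 0 t) (h2 : ∀ t, e t = e 0 → f t < R)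
    (t : ℝ) : e t = e 0 ∧ f t < R := by
  have hclopen : IsClopen {t | e t = e 0} := by
    refine ⟨isClosed_eq he continuous_const, ?_⟩
    rw [Metric.isOpen_iff]
    intro t ht
    have hopen : IsOpen {s | f s < R} := isOpen_lt hf continuous_const
    obtain ⟨ε, hε, hball⟩ := Metric.isOpen_iff.1 hopen t (h2 t ht)
    refine ⟨ε, hε, fun s hs => ?_⟩
    have hd : ∀ r ∈ Metric.ball t ε, HasDerivAt e 0 r := fun r hr => h1 r (le_of_lt (hball hr))
    have h := (convex_ball t ε).norm_image_sub_le_of_norm_hasDerivWithin_le (C := 0) (f := e)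
      (f' := fun _ => 0) (fun r hr => (hd r hr).hasDerivWithinAt) (by simp)
      (Metric.mem_ball_self hε) hs
    rw [zero_mul, norm_le_zero_iff, sub_eq_zero] at h
    exact h.trans ht
  have h := hclopen.eq_univ ⟨0, rfl⟩
  have ht : t ∈ {t | e t = e 0} := h ▸ mem_univ t
  exact ⟨ht, h2 t ht⟩

end ODE

section Product

variable {E F : Type*} [NormedAddCommGroup E] [NormedSpace ℂ E] [NormedAddCommGroup F]
  [NormedSpace ℂ F]

theorem tendsto_clm_apply_of_bounded {A : ℝ → E →L[ℂ] F} {M : ℝ} (hM : ∀ t, ‖A t‖ ≤ M)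
    (hA : ∀ x, Continuous fun t => A t x) {l : Filter ℝ} {t : ℝ} (hl : l ≤ nhds t) {q : ℝ → E}
    {x : E} (hq : Filter.Tendsto q l (nhds x)) :
    Filter.Tendsto (fun s => A s (q s)) l (nhds (A t x)) := by
  have h1 : Filter.Tendsto (fun s => A s x) l (nhds (A t x)) := ((hA x).tendsto t).mono_left hl
  have h2 : Filter.Tendsto (fun s => A s (q s - x)) l (nhds 0) := by
    have h3 : Filter.Tendsto (fun s => M * ‖q s - x‖) l (nhds 0) := by
      have := ((hq.sub_const x).norm.const_mul M)
      simpa using this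
    refine squeeze_zero_norm (fun s => ?_) h3
    exact ((A s).le_opNorm _).trans (mul_le_mul_of_nonneg_right (hM s) (norm_nonneg _))
  have h := h2.add h1
  rw [zero_add] at h
  refine h.congr fun s => ?_
  rw [← map_add, sub_add_cancel]

/-- The product rule for a uniformly bounded, strongly continuous family of operators. -/
theorem hasDerivAt_clm_apply_of_bounded {A : ℝ → E →L[ℂ] F} {M : ℝ} (hM : ∀ t, ‖A t‖ ≤ M)
    (hA : ∀ x, Continuous fun t => A t x) {w : ℝ → E} {w' : E} {d : F} {t : ℝ}
    (hw : HasDerivAt w w' t) (hd : HasDerivAt (fun s => A s (w t)) d t) :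
    HasDerivAt (fun s => A s (w s)) (d + A t w') t := by
  rw [hasDerivAt_iff_tendsto_slope] at hw hd ⊢
  refine (hd.add (tendsto_clm_apply_of_bounded hM hA nhdsWithin_le_nhds hw)).congr fun s => ?_
  rw [slope_def_module, slope_def_module, slope_def_module,
    ContinuousLinearMap.map_smul_of_tower (A s), map_sub, ← smul_add]
  congr 1
  abel

end Product

section Semilinear

variable {K : Type*} [NormedAddCommGroup K] [InnerProductSpace ℂ K] [CompleteSpace K]

/-- The right-hand side of `i ∂ₜ u = A u - N u` in the variable `w t = S (-t) (u t)`, where `S` is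
the group generated by `-i A`. -/
def interaction (S : ℝ → K →L[ℂ] K) (N : K → K) (t : ℝ) (x : K) : K :=
  Complex.I • S (-t) (N (S t x))

/-- Truncating a locally Lipschitz nonlinearity outside a ball makes the equation in interaction
variables globally solvable. -/
theorem exists_truncated_flow {S : ℝ → K →L[ℂ] K} {M : ℝ} (hM : ∀ t, ‖S t‖ ≤ M)
    (hS : ∀ x, Continuous fun t => S t x) {N : K → K}
    (hN : ∀ R, ∃ C, ∀ x y, ‖x‖ ≤ R → ‖y‖ ≤ R → ‖N x - N y‖ ≤ C * ‖x - y‖)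
    {R : ℝ} (hR : 0 < R) (x₀ : K) :
    ∃ w : ℝ → K, w 0 = x₀ ∧
      ∀ t, HasDerivAt w (interaction S (fun x => N (radial R x)) t (w t)) t := by
  obtain ⟨C, hC⟩ := hN R
  have hM0 : 0 ≤ M := (norm_nonneg _).trans (hM 0)
  have hSle : ∀ t x, ‖S t x‖ ≤ M * ‖x‖ := fun t x =>
    ((S t).le_opNorm x).trans (mul_le_mul_of_nonneg_right (hM t) (norm_nonneg _))
  have hlip : ∀ x y, ‖N (radial R x) - N (radial R y)‖ ≤ |C| * (2 * ‖x - y‖) := fun x y =>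
    (hC _ _ (norm_radial_le hR x) (norm_radial_le hR y)).trans
      (mul_le_mul (le_abs_self C) (norm_radial_sub_le hR x y) (norm_nonneg _) (abs_nonneg _))
  have hNc : Continuous fun x => N (radial R x) := by
    refine (LipschitzWith.of_dist_le_mul (K := ⟨|C| * 2, by positivity⟩) fun x y => ?_).continuous
    rw [dist_eq_norm, dist_eq_norm]
    exact (hlip x y).trans_eq (mul_assoc _ _ _).symm
  have hbd : ∀ x, ‖N (radial R x)‖ ≤ |C| * R + ‖N 0‖ := by
    intro x
    have h := hC (radial R x) 0 (norm_radial_le hR x) (by simpa using hR.le)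
    rw [sub_zero] at h
    have h2 := norm_sub_norm_le (N (radial R x)) (N 0)
    have h3 : C * ‖radial R x‖ ≤ |C| * R :=
      mul_le_mul (le_abs_self C) (norm_radial_le hR x) (norm_nonneg _) (abs_nonneg _)
    linarith
  refine exists_forall_hasDerivAt_of_lipschitz_of_bounded (C := ⟨M * (|C| * (2 * M)), by positivity⟩)
    (b := ⟨M * (|C| * R + ‖N 0‖), by positivity⟩) (fun t => ?_) (fun x => ?_) (fun t x => ?_) x₀
  · refine LipschitzWith.of_dist_le_mul fun x y => ?_
    rw [dist_eq_norm, dist_eq_norm, interaction, interaction, ← smul_sub, norm_smul,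
      Complex.norm_I, one_mul, ← map_sub]
    refine (hSle _ _).trans ?_
    have h1 := hlip (S t x) (S t y)
    have h2 := hSle t (x - y)
    rw [map_sub] at h2
    calc M * ‖N (radial R (S t x)) - N (radial R (S t y))‖
        ≤ M * (|C| * (2 * (M * ‖x - y‖))) := by gcongr; exact h1.trans (by gcongr)
      _ = M * (|C| * (2 * M)) * ‖x - y‖ := by ring
  · rw [continuous_iff_continuousAt]
    intro t
    have h := tendsto_clm_apply_of_bounded (A := fun t => S (-t)) (fun t => hM (-t))
      (fun x => (hS x).comp continuous_neg) le_rfl ((hNc.comp (hS x)).tendsto t)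
    exact h.const_smul Complex.I
  · rw [interaction, norm_smul, Complex.norm_I, one_mul]
    exact (hSle _ _).trans (mul_le_mul_of_nonneg_left (hbd _) hM0)

section Mild

variable {T B : K →L[ℂ] K} {S : ℝ → K →L[ℂ] K} (hS : IsFormGroup T B S) {N : K → K} {w : ℝ → K}
  (hw : ∀ t, HasDerivAt w (interaction S N t (w t)) t)

include hS hw

omit [CompleteSpace K] in
theorem IsFormGroup.continuous_mild : Continuous fun t => S t (w t) := by
  obtain ⟨M, hM⟩ := hS.bounded
  rw [continuous_iff_continuousAt]
  exact fun t => tendsto_clm_apply_of_bounded hM hS.cont le_rfl (hw t).continuousAt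

theorem IsFormGroup.hasDerivAt_mild (t : ℝ) : HasDerivAt (fun s => T (S s (w s)))
    (-Complex.I • B (S t (w t)) + Complex.I • T (N (S t (w t)))) t := by
  obtain ⟨M, hM⟩ := hS.bounded
  have h := hasDerivAt_clm_apply_of_bounded (A := fun s => T * S s) (M := ‖T‖ * M)
    (fun s => (norm_mul_le _ _).trans (mul_le_mul_of_nonneg_left (hM s) (norm_nonneg _)))
    (fun x => T.continuous.comp (hS.cont x)) (hw t) (hS.deriv t (w t))
  refine h.congr_deriv ?_
  have h1 : S t (S (-t) (N (S t (w t)))) = N (S t (w t)) := by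
    have := congrArg (fun A : K →L[ℂ] K => A (N (S t (w t)))) (hS.mul t (-t))
    simpa [hS.zero] using this
  rw [interaction, map_smul, mul_apply_eq_comp, h1]

theorem IsFormGroup.hasDerivAt_form (hB : IsSelfAdjoint B) (t : ℝ) :
    HasDerivAt (fun s => (inner ℂ (B (S s (w s))) (S s (w s))).re)
      (2 * (inner ℂ (B (S t (w t))) (Complex.I • N (S t (w t)))).re) t := by
  simp_rw [hS.inner_form]
  have hBw : HasDerivAt (fun s => B (w s)) (B (interaction S N t (w t))) t :=
    (B.restrictScalars ℝ).hasFDerivAt.comp_hasDerivAt t (hw t)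
  have h := Complex.reCLM.hasFDerivAt.comp_hasDerivAt t (hBw.inner ℂ (hw t))
  refine h.congr_deriv ?_
  have h1 : S t (S (-t) (N (S t (w t)))) = N (S t (w t)) := by
    have := congrArg (fun A : K →L[ℂ] K => A (N (S t (w t)))) (hS.mul t (-t))
    simpa [hS.zero] using this
  have h2 : inner ℂ (B (interaction S N t (w t))) (w t)
      = conj (inner ℂ (B (w t)) (interaction S N t (w t))) := by
    rw [inner_conj_symm]
    exact ContinuousLinearMap.isSelfAdjoint_iff_isSymmetric.1 hB _ _
  have h3 : inner ℂ (B (w t)) (interaction S N t (w t))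
      = inner ℂ (B (S t (w t))) (Complex.I • N (S t (w t))) := by
    rw [← hS.inner_form t, interaction, map_smul, h1]
  rw [h2, h3, Complex.reCLM_apply, Complex.add_re, Complex.conj_re]
  ring

end Mild

end Semilinear

/-! ### Weak derivatives on the circle and completeness of `H¹_per` -/

section Sobolev

variable {L : ℝ}

/-- A continuous `2L`-periodic function as a continuous function on the circle. -/
def onCircle (φ : ℝ → ℂ) (hc : Continuous φ) (hp : Function.Periodic φ (2 * L)) :
    C(AddCircle (2 * L), ℂ) :=
  ⟨hp.lift, continuous_coinduced_dom.2 hc⟩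

@[simp]
theorem onCircle_coe (φ : ℝ → ℂ) (hc : Continuous φ) (hp : Function.Periodic φ (2 * L)) (x : ℝ) :
    onCircle φ hc hp (x : AddCircle (2 * L)) = φ x := rfl

theorem contDiff_fourier_mode (k : ℤ) :
    ContDiff ℝ ∞ (fun y : ℝ => (fourier k (y : AddCircle (2 * L)) : ℂ)) := by
  simp_rw [fourier_coe_apply]
  have h0 : ContDiff ℝ ∞ (fun y : ℝ => (y : ℂ)) := Complex.ofRealCLM.contDiff
  exact ((contDiff_const.mul h0).div_const _).cexp

/-- The reflection of a continuous function on the circle. -/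
def reflCont (f : C(AddCircle (2 * L), ℂ)) : C(AddCircle (2 * L), ℂ) :=
  f.comp ⟨fun x => -x, continuous_neg⟩

@[simp]
theorem reflCont_apply (f : C(AddCircle (2 * L), ℂ)) (x : AddCircle (2 * L)) :
    reflCont f x = f (-x) := rfl

variable [Fact (0 < L)]

/-- The inclusion of the continuous functions on the circle in `L²_per`. -/
def contToL2 : C(AddCircle (2 * L), ℂ) →L[ℂ] L2per L := ContinuousMap.toLp (E := ℂ) 2 volume ℂ

theorem coeFn_contToL2 (f : C(AddCircle (2 * L), ℂ)) :
    (contToL2 f : AddCircle (2 * L) → ℂ) =ᵐ[volume] f := ContinuousMap.coeFn_toLp _ f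

/-- The bilinear pairing `∫ f ψ` of `L²_per` with a continuous function. -/
def pairing (ψ : C(AddCircle (2 * L), ℂ)) : L2per L →L[ℂ] ℂ := innerSL ℂ (contToL2 (star ψ))

theorem pairing_apply (ψ : C(AddCircle (2 * L), ℂ)) (f : L2per L) :
    pairing ψ f = ∫ y, f y * ψ y := by
  rw [pairing, innerSL_apply_apply, L2.inner_def]
  refine integral_congr_ae ?_
  filter_upwards [coeFn_contToL2 (star ψ)] with y hy
  rw [hy]
  simp

/-- The weak derivative in terms of the pairing on the circle. The regularity of `deriv φ`, which
follows from that of `φ`, is quantified over so that any proof of it can be supplied. -/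
theorem isWeakDeriv_iff {f g : L2per L} : IsWeakDeriv f g ↔
    ∀ (φ : ℝ → ℂ) (hφ : ContDiff ℝ ∞ φ) (hp : Function.Periodic φ (2 * L))
      (hd : Continuous (deriv φ)) (hp' : Function.Periodic (deriv φ) (2 * L)),
      pairing (onCircle (deriv φ) hd hp') f = -pairing (onCircle φ hφ.continuous hp) g := by
  refine forall_congr' fun φ => forall_congr' fun hφ => forall_congr' fun hp => ?_
  have hd : Continuous (deriv φ) := hφ.continuous_deriv (by simp)
  have hp' : Function.Periodic (deriv φ) (2 * L) := fun x => by
    rw [← deriv_comp_add_const]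
    exact congrArg (fun h => deriv h x) (funext hp)
  have h1 := intervalIntegral_circle (fun y => f y * onCircle (deriv φ) hd hp' y)
  have h2 := intervalIntegral_circle (fun y => g y * onCircle φ hφ.continuous hp y)
  simp only [onCircle_coe] at h1 h2
  rw [h1, h2, ← pairing_apply, ← pairing_apply]
  exact ⟨fun h _ _ => h, fun h => h hd hp'⟩

theorem isClosed_isWeakDeriv {X : Type*} [TopologicalSpace X] {F G : X → L2per L}
    (hF : Continuous F) (hG : Continuous G) : IsClosed {x | IsWeakDeriv (F x) (G x)} := by
  simp only [isWeakDeriv_iff, ofPred_forall]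
  refine isClosed_iInter fun φ => isClosed_iInter fun hφ => isClosed_iInter fun hp =>
    isClosed_iInter fun hd => isClosed_iInter fun hp' => isClosed_eq ?_ ?_
  · exact (pairing _).continuous.comp hF
  · exact ((pairing _).continuous.comp hG).neg

instance instCompleteSpaceH1per : CompleteSpace (H1per L) := by
  have : IsClosed (h1Submodule L : Set (WithLp 2 (L2per L × L2per L))) :=
    isClosed_isWeakDeriv (WithLp.fstL 2 ℂ (L2per L) (L2per L)).continuous
      (WithLp.sndL 2 ℂ (L2per L) (L2per L)).continuous
  exact this.completeSpace_coe

/-- The element of `H¹_per` given by a function and its weak derivative. -/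
def mkH1 (f g : L2per L) (h : IsWeakDeriv f g) : H1per L := ⟨WithLp.toLp 2 (f, g), h⟩

@[simp]
theorem toL2_mkH1 (f g : L2per L) (h : IsWeakDeriv f g) : toL2 (mkH1 f g h) = f := rfl

@[simp]
theorem dx_mkH1 (f g : L2per L) (h : IsWeakDeriv f g) : dx (mkH1 f g h) = g := rfl

theorem IsWeakDeriv.add {f g f' g' : L2per L} (h : IsWeakDeriv f g) (h' : IsWeakDeriv f' g') :
    IsWeakDeriv (f + f') (g + g') :=
  (h1Submodule L).add_mem (x := WithLp.toLp 2 (f, g)) (y := WithLp.toLp 2 (f', g')) h h'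

theorem IsWeakDeriv.smul {f g : L2per L} (c : ℂ) (h : IsWeakDeriv f g) :
    IsWeakDeriv (c • f) (c • g) :=
  (h1Submodule L).smul_mem c (x := WithLp.toLp 2 (f, g)) h

theorem inner_H1per (u v : H1per L) :
    inner ℂ u v = inner ℂ (toL2 u) (toL2 v) + inner ℂ (dx u) (dx v) :=
  WithLp.prod_inner_apply (Subtype.val u) (Subtype.val v)

theorem norm_toL2_le (u : H1per L) : ‖toL2 u‖ ≤ ‖u‖ := by
  refine le_of_sq_le_sq ?_ (norm_nonneg u)
  rw [norm_sq_H1per]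
  nlinarith [sq_nonneg ‖dx u‖]

theorem norm_dx_le (u : H1per L) : ‖dx u‖ ≤ ‖u‖ := by
  refine le_of_sq_le_sq ?_ (norm_nonneg u)
  rw [norm_sq_H1per]
  nlinarith [sq_nonneg ‖toL2 u‖]

theorem norm_H1per_le (u : H1per L) : ‖u‖ ≤ ‖toL2 u‖ + ‖dx u‖ := by
  refine le_of_sq_le_sq ?_ (by positivity)
  rw [norm_sq_H1per]
  nlinarith [mul_nonneg (norm_nonneg (toL2 u)) (norm_nonneg (dx u))]

theorem toL2_eq_contToL2 (u : H1per L) : toL2 u = contToL2 (toCont u) := by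
  refine Lp.ext ?_
  filter_upwards [coeFn_contToL2 (toCont u), toCont_ae_eq u] with x h1 h2
  rw [h1, h2]

theorem contToL2_injective : Function.Injective (contToL2 (L := L)) := by
  intro f g h
  have h1 : (f : AddCircle (2 * L) → ℂ) =ᵐ[volume] g :=
    (coeFn_contToL2 f).symm.trans (h ▸ coeFn_contToL2 g)
  exact DFunLike.coe_injective (Continuous.ae_eq_iff_eq volume f.continuous g.continuous |>.1 h1)

theorem eq_zero_of_fourierCoeff_eq_zero {f : L2per L}
    (h : ∀ k, fourierCoeff (f : AddCircle (2 * L) → ℂ) k = 0) : f = 0 := by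
  have hL : 0 < L := Fact.out
  have h1 := hasSum_sq_fourierCoeff_L2per f
  simp only [h, norm_zero, ne_eq, OfNat.ofNat_ne_zero, not_false_eq_true, zero_pow] at h1
  have h2 := h1.unique hasSum_zero
  have h3 : (2 * L)⁻¹ ≠ 0 := by positivity
  simpa [h3, hL.ne'] using h2

theorem fourierCoeff_zero_L2per (k : ℤ) :
    fourierCoeff ((0 : L2per L) : AddCircle (2 * L) → ℂ) k = 0 := by
  rw [fourierCoeff_congr_ae (ae_haar_iff.2 (Lp.coeFn_zero ℂ 2 volume))]
  simp [fourierCoeff]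

theorem toL2_injective : Function.Injective (toL2 (L := L)) := by
  rw [injective_iff_map_eq_zero]
  intro u hu
  have h1 : dx u = 0 := eq_zero_of_fourierCoeff_eq_zero fun k => by
    rw [fourierCoeff_dx, hu, fourierCoeff_zero_L2per, mul_zero]
  have h2 := norm_sq_H1per u
  rw [hu, h1] at h2
  simpa using h2

theorem toCont_injective : Function.Injective (toCont (L := L)) := fun u v h =>
  toL2_injective (by rw [toL2_eq_contToL2, toL2_eq_contToL2, h])

theorem toCont_eq_of_toL2_eq {u : H1per L} {f : C(AddCircle (2 * L), ℂ)}
    (h : toL2 u = contToL2 f) : toCont u = f :=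
  contToL2_injective (by rw [← toL2_eq_contToL2, h])

/-! ### Multiplication of functions in `H¹_per` -/

/-- Multiplication of `L²_per` by continuous functions. -/
def mulL2 : C(AddCircle (2 * L), ℂ) →L[ℂ] L2per L →L[ℂ] L2per L :=
  ((ContinuousLinearMap.mul ℂ ℂ).holderL volume ⊤ 2 2).comp
    (ContinuousMap.toLp (E := ℂ) ⊤ volume ℂ)

theorem coeFn_mulL2 (f : C(AddCircle (2 * L), ℂ)) (g : L2per L) :
    (mulL2 f g : AddCircle (2 * L) → ℂ) =ᵐ[volume] fun x => f x * g x := by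
  have h := (ContinuousLinearMap.mul ℂ ℂ).coeFn_holder (r := 2)
    (ContinuousMap.toLp (E := ℂ) ⊤ volume ℂ f) g
  filter_upwards [h, ContinuousMap.coeFn_toLp (p := ⊤) (𝕜 := ℂ) volume f] with x h1 h2
  change _ = _ at h1
  rw [ContinuousLinearMap.mul_apply', h2] at h1
  exact h1

theorem norm_mulL2_le (f : C(AddCircle (2 * L), ℂ)) (g : L2per L) :
    ‖mulL2 f g‖ ≤ ‖f‖ * ‖g‖ := by
  refine Lp.norm_le_mul_norm_of_ae_le_mul ?_
  filter_upwards [coeFn_mulL2 f g] with x hx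
  rw [hx, norm_mul]
  exact mul_le_mul_of_nonneg_right (f.norm_coe_le_norm x) (norm_nonneg _)

theorem mulL2_contToL2 (f g : C(AddCircle (2 * L), ℂ)) :
    mulL2 f (contToL2 g) = contToL2 (f * g) := by
  refine Lp.ext ?_
  filter_upwards [coeFn_mulL2 f (contToL2 g), coeFn_contToL2 g, coeFn_contToL2 (f * g)]
    with x h1 h2 h3
  rw [h1, h2, h3, ContinuousMap.mul_apply]

theorem pairing_mulL2 (ψ f : C(AddCircle (2 * L), ℂ)) (g : L2per L) :
    pairing ψ (mulL2 f g) = pairing (ψ * f) g := by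
  rw [pairing_apply, pairing_apply]
  refine integral_congr_ae ?_
  filter_upwards [coeFn_mulL2 f g] with x hx
  rw [hx, ContinuousMap.mul_apply]
  ring

/-- The factor by which differentiation multiplies the `k`-th Fourier mode. -/
def freq (L : ℝ) (k : ℤ) : ℂ := Complex.I * Real.pi * k / L

theorem hasDerivAt_fourier_mode (k : ℤ) (x : ℝ) :
    HasDerivAt (fun y : ℝ => (fourier k (y : AddCircle (2 * L)) : ℂ))
      (freq L k * fourier k (x : AddCircle (2 * L))) x := by
  have hL : (L : ℂ) ≠ 0 := by
    have : (0 : ℝ) < L := Fact.out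
    exact_mod_cast this.ne'
  convert! hasDerivAt_fourier (2 * L) k x using 1
  rw [freq]
  push_cast
  field_simp

theorem IsWeakDeriv.fourier_mul {f g : L2per L} (h : IsWeakDeriv f g) (k : ℤ) :
    IsWeakDeriv (mulL2 (fourier k) f) (mulL2 (fourier k) g + freq L k • mulL2 (fourier k) f) := by
  rw [isWeakDeriv_iff] at h ⊢
  intro φ hφ hp hd hp'
  set e : ℝ → ℂ := fun y => fourier k (y : AddCircle (2 * L)) with he
  have hec : ContDiff ℝ ∞ e := contDiff_fourier_mode k
  have hep : Function.Periodic e (2 * L) := fun x => by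
    simp only [he, AddCircle.coe_add_period]
  have hder : deriv (φ * e) = deriv φ * e + freq L k • (φ * e) := by
    ext x
    rw [((hφ.differentiable (by simp) x).hasDerivAt.mul (hasDerivAt_fourier_mode k x)).deriv]
    simp [he]
    ring
  have hec' : Continuous (deriv (φ * e)) := by
    rw [hder]
    exact (hd.mul hec.continuous).add ((hφ.continuous.mul hec.continuous).const_smul (freq L k))
  have hep' : Function.Periodic (deriv (φ * e)) (2 * L) := by
    rw [hder]
    exact (hp'.mul hep).add ((hp.mul hep).smul _)
  have h1 := h (φ * e) (hφ.mul hec) (hp.mul hep) hec' hep'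
  have h2 : onCircle (deriv φ) hd hp' * fourier k
      = onCircle (deriv (φ * e)) hec' hep' - freq L k • (onCircle φ hφ.continuous hp * fourier k) := by
    ext x
    induction x using QuotientAddGroup.induction_on with
    | H x =>
      have := congrFun hder x
      simp only [Pi.add_apply, Pi.mul_apply, Pi.smul_apply, smul_eq_mul] at this
      simp only [ContinuousMap.mul_apply, ContinuousMap.sub_apply, ContinuousMap.smul_apply,
        onCircle_coe, this, smul_eq_mul]
      simp [he]
  have h3 : onCircle φ hφ.continuous hp * fourier k
      = onCircle (φ * e) (hφ.mul hec).continuous (hp.mul hep) := by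
    ext x
    induction x using QuotientAddGroup.induction_on with
    | H x => rfl
  have hlin : ∀ (ψ χ : C(AddCircle (2 * L), ℂ)) (c : ℂ),
      pairing (ψ - c • χ) f = pairing ψ f - c * pairing χ f := by
    intro ψ χ c
    simp [pairing, star_sub, star_smul, map_sub, map_smul]
  rw [pairing_mulL2, h2, hlin, h1, map_add, map_smul, pairing_mulL2, pairing_mulL2, h3]
  simp only [smul_eq_mul]
  ring

theorem isWeakDeriv_one : IsWeakDeriv (contToL2 (1 : C(AddCircle (2 * L), ℂ))) 0 := by
  intro φ hφ hp
  rw [integral_zero_mul, neg_zero]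
  have h1 : ∫ x in (-L)..L, (contToL2 (1 : C(AddCircle (2 * L), ℂ)) : L2per L)
      (x : AddCircle (2 * L)) * deriv φ x = ∫ x in (-L)..L, deriv φ x := by
    refine intervalIntegral.integral_congr_ae ?_
    filter_upwards [ae_coe (coeFn_contToL2 (1 : C(AddCircle (2 * L), ℂ)))] with x hx hxI
    rw [hx hxI]
    simp
  rw [h1, intervalIntegral.integral_deriv_eq_sub (fun x _ => hφ.differentiable (by simp) x)
    ((hφ.continuous_deriv (by simp)).intervalIntegrable _ _)]
  have := hp (-L)
  rw [show -L + 2 * L = L by ring] at this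
  rw [this, sub_self]

/-- The Fourier mode `x ↦ exp (i π k x / L)` as an element of `H¹_per`. -/
def fourierH1 (k : ℤ) : H1per L := mkH1 _ _ (isWeakDeriv_one.fourier_mul k)

theorem toL2_fourierH1 (k : ℤ) : toL2 (fourierH1 k : H1per L) = contToL2 (fourier k) := by
  rw [fourierH1, toL2_mkH1, mulL2_contToL2, mul_one]

theorem dx_fourierH1 (k : ℤ) :
    dx (fourierH1 k : H1per L) = freq L k • contToL2 (fourier k) := by
  rw [fourierH1, dx_mkH1, mulL2_contToL2, mul_one, map_zero, zero_add]

theorem toCont_fourierH1 (k : ℤ) : toCont (fourierH1 k : H1per L) = fourier k :=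
  toCont_eq_of_toL2_eq (toL2_fourierH1 k)

theorem inner_fourier (k : ℤ) (f : L2per L) :
    inner ℂ (contToL2 (fourier k)) f
      = 2 * L * fourierCoeff (f : AddCircle (2 * L) → ℂ) k := by
  have hL : (L : ℂ) ≠ 0 := by
    have : (0 : ℝ) < L := Fact.out
    exact_mod_cast this.ne'
  have h1 : inner ℂ (contToL2 (fourier k)) f
      = ∫ x, fourier (-k) x * f x := by
    rw [L2.inner_def]
    refine integral_congr_ae ?_
    filter_upwards [coeFn_contToL2 (fourier k : C(AddCircle (2 * L), ℂ))] with y hy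
    rw [hy]
    simp [mul_comm]
  rw [h1, fourierCoeff, AddCircle.integral_haarAddCircle]
  simp only [smul_eq_mul, Complex.real_smul]
  push_cast
  field_simp

/-- Trigonometric polynomials are dense in `H¹_per`. -/
theorem eq_top_of_fourierH1_mem {P : Submodule ℂ (H1per L)} (hc : IsClosed (P : Set (H1per L)))
    (h : ∀ k, fourierH1 k ∈ P) : P = ⊤ := by
  have : CompleteSpace P := hc.completeSpace_coe
  rw [← Submodule.orthogonal_eq_bot_iff, Submodule.eq_bot_iff]
  intro u hu
  have hL : (L : ℂ) ≠ 0 := by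
    have : (0 : ℝ) < L := Fact.out
    exact_mod_cast this.ne'
  refine toL2_injective ?_
  rw [map_zero]
  refine eq_zero_of_fourierCoeff_eq_zero fun k => ?_
  have h1 := (Submodule.mem_orthogonal P u).1 hu _ (h k)
  rw [inner_H1per, toL2_fourierH1, dx_fourierH1, inner_smul_left, inner_fourier, inner_fourier,
    fourierCoeff_dx] at h1
  have h2 : (1 + conj (freq L k) * freq L k)
      * (2 * L * fourierCoeff (toL2 u : AddCircle (2 * L) → ℂ) k) = 0 := by
    rw [← h1, freq]
    ring
  have h3 : (1 + conj (freq L k) * freq L k) ≠ 0 := by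
    rw [Complex.conj_mul']
    norm_cast
    positivity
  have h4 := (mul_eq_zero.1 h2).resolve_left h3
  simpa [hL] using h4

/-- The Leibniz rule in `H¹_per`. -/
theorem isWeakDeriv_mulL2 (u v : H1per L) :
    IsWeakDeriv (mulL2 (toCont u) (toL2 v)) (mulL2 (toCont u) (dx v) + mulL2 (toCont v) (dx u)) := by
  let P : Submodule ℂ (H1per L) :=
    { carrier := {u | IsWeakDeriv (mulL2 (toCont u) (toL2 v))
        (mulL2 (toCont u) (dx v) + mulL2 (toCont v) (dx u))}
      add_mem' := fun {a b} ha hb => by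
        have h := IsWeakDeriv.add ha hb
        simp only [mem_ofPred_eq, map_add, add_apply]
        rwa [add_add_add_comm] at h
      zero_mem' := by
        simp only [mem_ofPred_eq, map_zero, zero_apply, add_zero]
        exact (h1Submodule L).zero_mem
      smul_mem' := fun c a ha => by
        have h := IsWeakDeriv.smul c ha
        simp only [mem_ofPred_eq, map_smul, smul_apply]
        rwa [smul_add] at h }
  have hP : ∀ u, u ∈ P ↔ IsWeakDeriv (mulL2 (toCont u) (toL2 v))
      (mulL2 (toCont u) (dx v) + mulL2 (toCont v) (dx u)) := fun u => Iff.rfl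
  rw [← hP, eq_top_of_fourierH1_mem (P := P)]
  · trivial
  · refine isClosed_isWeakDeriv ?_ ?_
    · fun_prop
    · fun_prop
  · intro k
    rw [hP, toCont_fourierH1, dx_fourierH1, map_smul, mulL2_contToL2, mul_comm (toCont v), ← mulL2_contToL2,
      ← toL2_eq_contToL2]
    exact (isWeakDeriv_dx v).fourier_mul k

/-- The product of two functions in `H¹_per`. -/
def mulH1 (u v : H1per L) : H1per L := mkH1 _ _ (isWeakDeriv_mulL2 u v)

@[simp]
theorem toCont_mulH1 (u v : H1per L) : toCont (mulH1 u v) = toCont u * toCont v :=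
  toCont_eq_of_toL2_eq (by rw [mulH1, toL2_mkH1, toL2_eq_contToL2, mulL2_contToL2])

theorem exists_norm_mulH1_le : ∃ C, 0 ≤ C ∧ ∀ u v : H1per L, ‖mulH1 u v‖ ≤ C * ‖u‖ * ‖v‖ := by
  refine ⟨3 * ‖toCont (L := L)‖, by positivity, fun u v => (norm_H1per_le _).trans ?_⟩
  rw [mulH1, toL2_mkH1, dx_mkH1]
  have h1 := norm_mulL2_le (toCont u) (toL2 v)
  have h2 := norm_mulL2_le (toCont u) (dx v)
  have h3 := norm_mulL2_le (toCont v) (dx u)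
  have h4 := norm_add_le (mulL2 (toCont u) (dx v)) (mulL2 (toCont v) (dx u))
  have hu := toCont.le_opNorm u
  have hv := toCont.le_opNorm v
  have a1 : ‖toCont u‖ * ‖toL2 v‖ ≤ (‖toCont (L := L)‖ * ‖u‖) * ‖v‖ := by
    gcongr; exact norm_toL2_le v
  have a2 : ‖toCont u‖ * ‖dx v‖ ≤ (‖toCont (L := L)‖ * ‖u‖) * ‖v‖ := by
    gcongr; exact norm_dx_le v
  have a3 : ‖toCont v‖ * ‖dx u‖ ≤ (‖toCont (L := L)‖ * ‖v‖) * ‖u‖ := by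
    gcongr; exact norm_dx_le u
  linarith

/-! ### Complex conjugation and reflection in `H¹_per` -/

/-- Complex conjugation on `L²_per`. -/
def conjL2 (f : L2per L) : L2per L := star f

theorem coeFn_conjL2 (f : L2per L) :
    (conjL2 f : AddCircle (2 * L) → ℂ) =ᵐ[volume] fun x => conj (f x) := Lp.coeFn_star f

theorem norm_conjL2 (f : L2per L) : ‖conjL2 f‖ = ‖f‖ := by
  refine le_antisymm (Lp.norm_le_norm_of_ae_le ?_) (Lp.norm_le_norm_of_ae_le ?_) <;>
  · filter_upwards [coeFn_conjL2 f] with x hx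
    rw [hx, RCLike.norm_conj]

theorem pairing_conjL2 (ψ : C(AddCircle (2 * L), ℂ)) (f : L2per L) :
    pairing ψ (conjL2 f) = conj (pairing (star ψ) f) := by
  rw [pairing_apply, pairing_apply, ← integral_conj]
  refine integral_congr_ae ?_
  filter_upwards [coeFn_conjL2 f] with x hx
  rw [hx]
  simp

theorem IsWeakDeriv.conj {f g : L2per L} (h : IsWeakDeriv f g) :
    IsWeakDeriv (conjL2 f) (conjL2 g) := by
  rw [isWeakDeriv_iff] at h ⊢
  intro φ hφ hp hd hp'
  have hc : ContDiff ℝ ∞ (fun x => star (φ x)) :=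
    (Complex.conjCLE : ℂ →L[ℝ] ℂ).contDiff.comp hφ
  have hder : deriv (fun x => star (φ x)) = fun x => star (deriv φ x) := by
    ext x
    exact (hφ.differentiable (by simp) x).hasDerivAt.star.deriv
  have hsp : Function.Periodic (fun x => star (φ x)) (2 * L) := fun x => congrArg star (hp x)
  have hsd : Continuous (deriv fun x => star (φ x)) := by
    rw [hder]
    exact hd.star
  have hsp' : Function.Periodic (deriv fun x => star (φ x)) (2 * L) := by
    rw [hder]
    exact fun x => congrArg star (hp' x)
  have h1 := h (fun x => star (φ x)) hc hsp
    hsd hsp'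
  have h2 : star (onCircle (deriv φ) hd hp') = onCircle (deriv fun x => star (φ x))
      hsd hsp' := by
    ext x
    induction x using QuotientAddGroup.induction_on with
    | H x => exact (congrFun hder x).symm
  have h3 : star (onCircle φ hφ.continuous hp) = onCircle (fun x => star (φ x))
      hc.continuous hsp := by
    ext x
    induction x using QuotientAddGroup.induction_on with
    | H x => rfl
  rw [pairing_conjL2, pairing_conjL2, h2, h3, h1, map_neg]

/-- The complex conjugate of a function in `H¹_per`. -/
def conjH1 (u : H1per L) : H1per L := mkH1 _ _ (isWeakDeriv_dx u).conj

@[simp]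
theorem toCont_conjH1 (u : H1per L) : toCont (conjH1 u) = star (toCont u) := by
  refine toCont_eq_of_toL2_eq (Lp.ext ?_)
  rw [conjH1, toL2_mkH1]
  filter_upwards [coeFn_conjL2 (toL2 u), toCont_ae_eq u, coeFn_contToL2 (star (toCont u))]
    with x h1 h2 h3
  rw [h1, h3, ← h2]
  simp

theorem norm_conjH1 (u : H1per L) : ‖conjH1 u‖ = ‖u‖ := by
  rw [← sq_eq_sq₀ (norm_nonneg _) (norm_nonneg _), norm_sq_H1per, norm_sq_H1per, conjH1, toL2_mkH1,
    dx_mkH1, norm_conjL2, norm_conjL2]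

theorem measurePreserving_neg :
    MeasurePreserving (fun x : AddCircle (2 * L) => -x) volume volume :=
  Measure.measurePreserving_neg volume

/-- The reflection `f ↦ f (-x)` of `L²_per`. -/
def reflL2 : L2per L →L[ℂ] L2per L :=
  (Lp.compMeasurePreservingₗᵢ ℂ (fun x : AddCircle (2 * L) => -x)
    measurePreserving_neg).toContinuousLinearMap

theorem coeFn_reflL2 (f : L2per L) :
    (reflL2 f : AddCircle (2 * L) → ℂ) =ᵐ[volume] fun x => f (-x) :=
  Lp.coeFn_compMeasurePreserving f measurePreserving_neg

theorem norm_reflL2 (f : L2per L) : ‖reflL2 f‖ = ‖f‖ :=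
  (Lp.compMeasurePreservingₗᵢ ℂ (fun x : AddCircle (2 * L) => -x)
    measurePreserving_neg).norm_map f

theorem integral_comp_neg_circle (F : AddCircle (2 * L) → ℂ) : ∫ x, F (-x) = ∫ x, F x :=
  integral_neg_eq_self F volume

theorem pairing_reflL2 (ψ : C(AddCircle (2 * L), ℂ)) (f : L2per L) :
    pairing ψ (reflL2 f) = pairing (reflCont ψ) f := by
  rw [pairing_apply, pairing_apply, ← integral_comp_neg_circle]
  refine integral_congr_ae ?_
  filter_upwards [measurePreserving_neg.quasiMeasurePreserving.ae (coeFn_reflL2 f)] with x hx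
  rw [hx, neg_neg, reflCont_apply]

theorem IsWeakDeriv.refl {f g : L2per L} (h : IsWeakDeriv f g) :
    IsWeakDeriv (reflL2 f) (-reflL2 g) := by
  rw [isWeakDeriv_iff] at h ⊢
  intro φ hφ hp hd hp'
  have hc : ContDiff ℝ ∞ (fun x => φ (-x)) := hφ.comp contDiff_neg
  have hq : ∀ {χ : ℝ → ℂ}, Function.Periodic χ (2 * L) →
      Function.Periodic (fun x => χ (-x)) (2 * L) := by
    intro χ hχ x
    change χ (-(x + 2 * L)) = χ (-x)
    rw [← hχ, neg_add, neg_add_cancel_right]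
  have hder : deriv (fun x => φ (-x)) = fun x => -deriv φ (-x) := by
    ext x
    exact deriv_comp_neg φ x
  have hd' : Continuous (deriv (fun x => φ (-x))) := by
    rw [hder]; exact (hd.comp continuous_neg).neg
  have hq' : Function.Periodic (deriv (fun x => φ (-x))) (2 * L) := by
    rw [hder]; exact fun x => congrArg Neg.neg (hq hp' x)
  have h1 := h (fun x => φ (-x)) hc (hq hp) hd' hq'
  have h2 : reflCont (onCircle (deriv φ) hd hp') = -onCircle (deriv fun x => φ (-x)) hd' hq' := by
    ext x
    induction x using QuotientAddGroup.induction_on with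
    | H x =>
      have := congrFun hder x
      rw [ContinuousMap.neg_apply, reflCont_apply, onCircle_coe, this, neg_neg]
      rfl
  have h3 : reflCont (onCircle φ hφ.continuous hp)
      = onCircle (fun x => φ (-x)) hc.continuous (hq hp) := by
    ext x
    induction x using QuotientAddGroup.induction_on with
    | H x => rfl
  have hneg : ∀ (ψ : C(AddCircle (2 * L), ℂ)) (f : L2per L), pairing (-ψ) f = -pairing ψ f := by
    intro ψ f
    simp [pairing]
  rw [pairing_reflL2, map_neg, pairing_reflL2, h2, h3, hneg, h1]

/-- The reflection `u ↦ u (-x)` of `H¹_per`. -/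
def reflH1 : H1per L →L[ℂ] H1per L :=
  LinearMap.mkContinuous
    { toFun := fun u => mkH1 _ _ (isWeakDeriv_dx u).refl
      map_add' := fun u v => toL2_injective (by simp)
      map_smul' := fun c u => toL2_injective (by simp) } 1 fun u => by
    rw [one_mul]
    refine le_of_sq_le_sq ?_ (norm_nonneg u)
    rw [norm_sq_H1per, norm_sq_H1per]
    simp [norm_reflL2]

@[simp]
theorem toL2_reflH1 (u : H1per L) : toL2 (reflH1 u) = reflL2 (toL2 u) := rfl

@[simp]
theorem dx_reflH1 (u : H1per L) : dx (reflH1 u) = -reflL2 (dx u) := rfl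

@[simp]
theorem toCont_reflH1 (u : H1per L) : toCont (reflH1 u) = reflCont (toCont u) := by
  refine toCont_eq_of_toL2_eq (Lp.ext ?_)
  rw [toL2_reflH1]
  filter_upwards [coeFn_reflL2 (toL2 u),
    measurePreserving_neg.quasiMeasurePreserving.ae (toCont_ae_eq u),
    coeFn_contToL2 (reflCont (toCont u))] with x h1 h2 h3
  rw [h1, h3, reflCont_apply, ← h2]

end Sobolev

/-! ### The cubic nonlinearity on `H¹_per` -/

section Nonlinearity

variable {L : ℝ} [Fact (0 < L)]

theorem mulH1_sub_sub (u v u' v' : H1per L) :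
    mulH1 u v - mulH1 u' v' = mulH1 (u - u') v + mulH1 u' (v - v') :=
  toCont_injective (by simp only [toCont_mulH1, map_sub, map_add]; ring)

theorem continuous_mulH1 {X : Type*} [TopologicalSpace X] {f g : X → H1per L}
    (hf : Continuous f) (hg : Continuous g) : Continuous fun x => mulH1 (f x) (g x) := by
  obtain ⟨C, hC, hb⟩ := exists_norm_mulH1_le (L := L)
  rw [continuous_iff_continuousAt]
  intro x
  rw [ContinuousAt, tendsto_iff_norm_sub_tendsto_zero]
  have h : Filter.Tendsto (fun y => C * ‖f y - f x‖ * ‖g y‖ + C * ‖f x‖ * ‖g y - g x‖)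
      (nhds x) (nhds 0) := by
    have : Continuous fun y => C * ‖f y - f x‖ * ‖g y‖ + C * ‖f x‖ * ‖g y - g x‖ := by fun_prop
    simpa using this.tendsto x
  refine squeeze_zero (fun _ => norm_nonneg _) (fun y => ?_) h
  rw [mulH1_sub_sub]
  exact (norm_add_le _ _).trans (add_le_add (hb _ _) (hb _ _))

theorem conjH1_sub (u v : H1per L) : conjH1 (u - v) = conjH1 u - conjH1 v :=
  toCont_injective (by simp)

theorem continuous_conjH1 : Continuous (conjH1 (L := L)) :=
  (LipschitzWith.of_dist_le_mul (K := 1) fun u v => by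
    rw [dist_eq_norm, dist_eq_norm, ← conjH1_sub, norm_conjH1, NNReal.coe_one, one_mul]).continuous

/-- The cubic nonlinearity `|u|² u` as an element of `H¹_per`. -/
def cubicH1 (u : H1per L) : H1per L := mulH1 (mulH1 u (conjH1 u)) u

theorem toCont_cubicH1 (u : H1per L) : toCont (cubicH1 u) = cubic u := by
  ext x
  simp only [cubicH1, toCont_mulH1, toCont_conjH1, ContinuousMap.mul_apply, ContinuousMap.star_apply,
    cubic, ContinuousMap.coe_mk, Complex.star_def, Complex.mul_conj']

theorem toL2_cubicH1 (u : H1per L) : toL2 (cubicH1 u) = contToL2 (cubic u) := by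
  rw [toL2_eq_contToL2, toCont_cubicH1]

/-- The difference of two cubic terms factors through the difference of the arguments. -/
theorem cubicH1_sub (u v : H1per L) : cubicH1 u - cubicH1 v
    = mulH1 (mulH1 (u + v) (conjH1 u)) (u - v) + mulH1 (mulH1 v v) (conjH1 (u - v)) :=
  toCont_injective (by
    simp only [cubicH1, map_sub, map_add, toCont_mulH1, toCont_conjH1, star_sub]
    ring)

theorem exists_norm_cubicH1_sub_le (R : ℝ) : ∃ C, ∀ u v : H1per L, ‖u‖ ≤ R → ‖v‖ ≤ R →
    ‖cubicH1 u - cubicH1 v‖ ≤ C * ‖u - v‖ := by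
  obtain ⟨C, hC, hb⟩ := exists_norm_mulH1_le (L := L)
  refine ⟨C * (C * (R + R) * R) + C * (C * R * R), fun u v hu hv => ?_⟩
  have hR : 0 ≤ R := (norm_nonneg u).trans hu
  have h1 : ‖mulH1 (u + v) (conjH1 u)‖ ≤ C * (R + R) * R := by
    refine (hb _ _).trans ?_
    rw [norm_conjH1]
    gcongr
    exact (norm_add_le _ _).trans (add_le_add hu hv)
  have h2 : ‖mulH1 v v‖ ≤ C * R * R := (hb _ _).trans (by gcongr)
  rw [cubicH1_sub, add_mul]
  refine (norm_add_le _ _).trans (add_le_add ((hb _ _).trans ?_) ((hb _ _).trans ?_))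
  · gcongr
  · rw [norm_conjH1]
    gcongr

/-! ### An interpolation inequality for the supremum norm -/

theorem norm_fourierCoeff_le (f : L2per L) (k : ℤ) :
    ‖fourierCoeff (f : AddCircle (2 * L) → ℂ) k‖ ≤ √((2 * L)⁻¹) * ‖f‖ := by
  have hL : 0 < L := Fact.out
  refine le_of_sq_le_sq ?_ (by positivity)
  rw [mul_pow, Real.sq_sqrt (by positivity)]
  have h := hasSum_sq_fourierCoeff_L2per f
  exact le_hasSum h k fun j _ => sq_nonneg ‖fourierCoeff (f : AddCircle (2 * L) → ℂ) j‖

theorem norm_fourierCoeff_eq_mul (u : H1per L) {k : ℤ} (hk : k ≠ 0) :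
    ‖fourierCoeff (toL2 u : AddCircle (2 * L) → ℂ) k‖
      = |L / (Real.pi * k)| * ‖fourierCoeff (dx u : AddCircle (2 * L) → ℂ) k‖ := by
  have hL : L ≠ 0 := (Fact.out : 0 < L).ne'
  have hk' : (k : ℝ) ≠ 0 := by exact_mod_cast hk
  have h2 : ‖Complex.I * Real.pi * k / L‖ = |Real.pi * k / L| := by
    rw [norm_div, norm_mul, norm_mul, Complex.norm_I, one_mul, abs_div, abs_mul]
    simp
  have h3 : L / (Real.pi * k) * (Real.pi * k / L) = 1 := by
    field_simp
  rw [fourierCoeff_dx, norm_mul, h2, ← mul_assoc, ← abs_mul, h3, abs_one, one_mul]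

theorem norm_toCont_le_tsum (u : H1per L) :
    ‖toCont u‖ ≤ ∑' k, ‖fourierCoeff (toL2 u : AddCircle (2 * L) → ℂ) k‖ := by
  obtain ⟨C, hC⟩ := fourierCoeff_bound (L := L)
  have hc : fourierCoeff (toCont u : AddCircle (2 * L) → ℂ)
      = fourierCoeff (toL2 u : AddCircle (2 * L) → ℂ) :=
    fourierCoeff_congr_ae (ae_haar_iff.2 (toCont_ae_eq u))
  have hs : Summable (fourierCoeff (toCont u : AddCircle (2 * L) → ℂ)) := by
    rw [hc]
    exact (hC u).1.of_norm
  have h := (hasSum_fourier_series_of_summable hs).tsum_eq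
  rw [← h, hc]
  refine (norm_tsum_le_tsum_norm ?_).trans_eq ?_
  · simp_rw [norm_smul, fourier_norm, mul_one]
    exact (hC u).1
  · simp_rw [norm_smul, fourier_norm, mul_one]

/-- Low Fourier modes are controlled by the `L²` norm and high ones by a small multiple of the `H¹`
norm. -/
theorem exists_norm_toCont_le {ε : ℝ} (hε : 0 < ε) :
    ∃ C, 0 ≤ C ∧ ∀ u : H1per L, ‖toCont u‖ ≤ ε * ‖u‖ + C * ‖toL2 u‖ := by
  have hL : 0 < L := Fact.out
  obtain ⟨b, hb0, -, hbk, hbs⟩ := exists_summable_weight L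
  obtain ⟨C0, hC0⟩ := fourierCoeff_bound (L := L)
  have htail := tendsto_tsum_compl_atTop_zero fun k => b k ^ 2
  -- The mode `0` must be low, since the derivative does not control it.
  obtain ⟨s, hs⟩ := (htail.eventually_lt_const
    (show (0 : ℝ) < ε ^ 2 * (2 * L) by positivity)).and (Filter.eventually_ge_atTop {0}) |>.exists
  refine ⟨s.card * √((2 * L)⁻¹), by positivity, fun u => ?_⟩
  set c : ℤ → ℝ := fun k => ‖fourierCoeff (toL2 u : AddCircle (2 * L) → ℂ) k‖ with hc
  set d : ℤ → ℝ := fun k => ‖fourierCoeff (dx u : AddCircle (2 * L) → ℂ) k‖ with hd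
  have hcs : Summable c := (hC0 u).1
  have hds := hasSum_sq_fourierCoeff_L2per (dx u)
  have h1 : ∑ k ∈ s, c k ≤ s.card * √((2 * L)⁻¹) * ‖toL2 u‖ := by
    have := Finset.sum_le_card_nsmul s c _ fun k _ => norm_fourierCoeff_le (toL2 u) k
    rwa [nsmul_eq_mul, ← mul_assoc] at this
  have hmem : ∀ k : {k // k ∉ s}, (k : ℤ) ≠ 0 := fun k hk =>
    k.2 (by rw [hk]; exact Finset.singleton_subset_iff.1 hs.2)
  have h2 : ∑' k : {k // k ∉ s}, c k ≤ ε * ‖u‖ := by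
    have hbs' : Summable fun k : {k // k ∉ s} => b k ^ (2 : ℝ) := by
      simp only [Real.rpow_ofNat]
      exact hbs.subtype {k | k ∉ s}
    have hds' : Summable fun k : {k // k ∉ s} => d k ^ (2 : ℝ) := by
      simp only [Real.rpow_ofNat]
      exact hds.summable.subtype {k | k ∉ s}
    have hCS := Real.inner_le_Lp_mul_Lq_tsum_of_nonneg Real.HolderConjugate.two_two
      (fun k : {k // k ∉ s} => hb0 k) (fun k => norm_nonneg _) hbs' hds'
    have heq : ∑' k : {k // k ∉ s}, c k = ∑' k : {k // k ∉ s}, b k * d k :=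
      tsum_congr fun k => by rw [hbk _ (hmem k)]; exact norm_fourierCoeff_eq_mul u (hmem k)
    have hd2 : ∑' k : {k // k ∉ s}, d k ^ 2 ≤ (2 * L)⁻¹ * ‖u‖ ^ 2 := by
      refine (hds.summable.tsum_subtype_le (fun k => d k ^ 2) {k | k ∉ s}
        (fun k => by positivity)).trans ?_
      rw [hds.tsum_eq]
      gcongr
      exact norm_dx_le u
    rw [heq]
    refine hCS.trans ?_
    simp only [Real.rpow_ofNat, ← Real.sqrt_eq_rpow]
    rw [← Real.sqrt_mul (tsum_nonneg fun _ => sq_nonneg _)]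
    refine Real.sqrt_le_iff.2 ⟨by positivity, ?_⟩
    calc _ ≤ (ε ^ 2 * (2 * L)) * ((2 * L)⁻¹ * ‖u‖ ^ 2) :=
          mul_le_mul hs.1.le hd2 (tsum_nonneg fun _ => sq_nonneg _) (by positivity)
      _ = _ := by field_simp
  have h3 := hcs.sum_add_tsum_compl (s := s)
  have h4 := norm_toCont_le_tsum u
  change ‖toCont u‖ ≤ ∑' k, c k at h4
  have h5 : ∑' k : ((s : Set ℤ)ᶜ : Set ℤ), c k = ∑' k : {k // k ∉ s}, c k := rfl
  rw [← h3, h5] at h4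
  linarith

theorem exists_norm_toCont_sq_le {ε : ℝ} (hε : 0 < ε) :
    ∃ C, 0 ≤ C ∧ ∀ u : H1per L, ‖toCont u‖ ^ 2 ≤ ε * ‖u‖ ^ 2 + C * ‖toL2 u‖ ^ 2 := by
  obtain ⟨C, hC, h⟩ := exists_norm_toCont_le (L := L) (ε := √(ε / 2)) (by positivity)
  refine ⟨2 * C ^ 2, by positivity, fun u => ?_⟩
  have h1 := pow_le_pow_left₀ (norm_nonneg _) (h u) 2
  have h2 : √(ε / 2) ^ 2 = ε / 2 := Real.sq_sqrt (by positivity)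
  nlinarith [sq_nonneg (√(ε / 2) * ‖u‖ - C * ‖toL2 u‖), sq_nonneg ‖u‖]

/-! ### The quadratic form of the linear part -/

/-- The `L²` inner product, as an operator on `H¹_per`. -/
def massOp : H1per L →L[ℂ] H1per L := toL2.adjoint.comp toL2

/-- The value at the origin. -/
def evalZero : H1per L →L[ℂ] ℂ :=
  (ContinuousMap.evalCLM ℂ (0 : AddCircle (2 * L))).comp toCont

@[simp]
theorem evalZero_apply (u : H1per L) : evalZero u = toCont u 0 := rfl

/-- The form of `-∂ₓ² + l - Z δ`, as an operator on `H¹_per`. -/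
def formOp (Z l : ℝ) : H1per L →L[ℂ] H1per L :=
  dx.adjoint.comp dx + (l : ℂ) • massOp - (Z : ℂ) • evalZero.adjoint.comp evalZero

theorem inner_massOp (u v : H1per L) : inner ℂ u (massOp v) = inner ℂ (toL2 u) (toL2 v) := by
  rw [massOp, ContinuousLinearMap.comp_apply, ContinuousLinearMap.adjoint_inner_right]

theorem inner_formOp (Z l : ℝ) (u v : H1per L) : inner ℂ u (formOp Z l v)
    = inner ℂ (dx u) (dx v) + l * inner ℂ (toL2 u) (toL2 v)
      - Z * (toCont v 0 * conj (toCont u 0)) := by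
  simp only [formOp, sub_apply, add_apply, smul_apply, ContinuousLinearMap.comp_apply,
    inner_sub_right, inner_add_right, inner_smul_right, ContinuousLinearMap.adjoint_inner_right,
    inner_massOp, RCLike.inner_apply, evalZero_apply]

theorem isSelfAdjoint_massOp : IsSelfAdjoint (massOp (L := L)) := by
  rw [ContinuousLinearMap.isSelfAdjoint_iff_isSymmetric]
  intro u v
  have h1 := inner_massOp u v
  have h2 := inner_massOp v u
  rw [← inner_conj_symm] at h2
  have h3 := congrArg conj h2
  rw [Complex.conj_conj, inner_conj_symm] at h3
  exact h3.trans h1.symm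

theorem isSelfAdjoint_formOp (Z l : ℝ) : IsSelfAdjoint (formOp (L := L) Z l) := by
  rw [ContinuousLinearMap.isSelfAdjoint_iff_isSymmetric]
  intro u v
  change inner ℂ (formOp Z l u) v = inner ℂ u (formOp Z l v)
  rw [← inner_conj_symm, inner_formOp, inner_formOp]
  simp only [map_sub, map_add, map_mul, Complex.conj_ofReal, inner_conj_symm, Complex.conj_conj]
  ring

theorem massOp_injective : Function.Injective (massOp (L := L)) := by
  rw [injective_iff_map_eq_zero]
  intro u hu
  have h := inner_massOp u u
  rw [hu, inner_zero_right] at h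
  refine toL2_injective ?_
  rw [map_zero]
  exact inner_self_eq_zero.1 h.symm

theorem re_inner_formOp_self (Z l : ℝ) (u : H1per L) : (inner ℂ u (formOp Z l u)).re
    = ‖dx u‖ ^ 2 + l * ‖toL2 u‖ ^ 2 - Z * ‖toCont u 0‖ ^ 2 := by
  rw [inner_formOp, inner_self_eq_norm_sq_to_K, inner_self_eq_norm_sq_to_K, Complex.mul_conj']
  simp only [Complex.coe_algebraMap]
  norm_cast

theorem exists_formOp_coercive (Z : ℝ) : ∃ l : ℝ, ∀ u : H1per L,
    1 / 2 * ‖u‖ ^ 2 ≤ (inner ℂ (formOp Z l u) u).re := by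
  obtain ⟨C, hC, h⟩ := exists_norm_toCont_sq_le (L := L) (ε := 1 / (2 * (|Z| + 1))) (by positivity)
  refine ⟨1 + |Z| * C, fun u => ?_⟩
  rw [← inner_conj_symm, Complex.conj_re, re_inner_formOp_self]
  have h1 : ‖toCont u 0‖ ^ 2 ≤ ‖toCont u‖ ^ 2 :=
    pow_le_pow_left₀ (norm_nonneg _) ((toCont u).norm_coe_le_norm 0) 2
  have h2 : Z * ‖toCont u 0‖ ^ 2 ≤ |Z| * (1 / (2 * (|Z| + 1)) * ‖u‖ ^ 2 + C * ‖toL2 u‖ ^ 2) :=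
    mul_le_mul (le_abs_self Z) (h1.trans (h u)) (sq_nonneg _) (abs_nonneg _)
  have h3 : |Z| * (1 / (2 * (|Z| + 1))) ≤ 1 / 2 := by
    rw [mul_one_div, div_le_div_iff₀ (by positivity) (by positivity)]
    linarith
  have h4 : |Z| * (1 / (2 * (|Z| + 1))) * ‖u‖ ^ 2 ≤ 1 / 2 * ‖u‖ ^ 2 := by gcongr
  nlinarith [norm_sq_H1per u]

/-- The Riesz isomorphism of `H¹_per` with its conjugate dual `H⁻¹_per`. -/
def riesz : H1per L →L[ℂ] Hneg1per L := innerSLFlip ℂ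

theorem riesz_apply (u v : H1per L) : riesz u v = inner ℂ v u := rfl

theorem toHneg1_eq (u : H1per L) : toHneg1 u = riesz (massOp u) := by
  ext v
  rw [riesz_apply, inner_massOp]
  rfl

theorem cubicHneg1_eq (u : H1per L) : cubicHneg1 u = riesz (massOp (cubicH1 u)) := by
  rw [← toHneg1_eq, toHneg1, toL2_cubicH1]
  rfl

theorem dxx_add_diracMul (Z l : ℝ) (u : H1per L) :
    dxx u + (Z : ℂ) • diracMul u = riesz ((l : ℂ) • massOp u - formOp Z l u) := by
  ext v
  rw [riesz_apply, inner_sub_right, inner_formOp, inner_smul_right, inner_massOp]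
  have h1 : dxx u v = -inner ℂ (dx v) (dx u) := rfl
  rw [add_apply, smul_apply, h1, diracMul_apply, smul_eq_mul]
  ring

end Nonlinearity

/-! ### Conservation of charge and energy -/

section Conservation

variable {L : ℝ} [Fact (0 < L)]

/-- The derivative of a functional whose increments are duality pairings of the increments of a
curve that is differentiable in `H⁻¹_per` only, with a factor that is continuous in `H¹_per`. -/
theorem hasDerivWithinAt_of_pairing {f : ℝ → ℝ} {p : ℝ → Hneg1per L} {q : ℝ → H1per L}
    {I : Set ℝ} {t : ℝ} {d : Hneg1per L} (hf : ∀ s, f s - f t = ((p s - p t) (q s)).re)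
    (hp : HasDerivWithinAt p d I t) (hq : ContinuousWithinAt q I t) :
    HasDerivWithinAt f (d (q t)).re I t := by
  rw [hasDerivWithinAt_iff_tendsto_slope] at hp ⊢
  have hq' : Filter.Tendsto q (nhdsWithin t (I \ {t})) (nhds (q t)) :=
    hq.tendsto.mono_left (nhdsWithin_mono _ sdiff_subset)
  have h : Filter.Tendsto (fun s => slope p t s (q s)) (nhdsWithin t (I \ {t})) (nhds (d (q t))) := by
    have h1 : Filter.Tendsto (fun s => ‖slope p t s - d‖ * ‖q s‖ + ‖d‖ * ‖q s - q t‖)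
        (nhdsWithin t (I \ {t})) (nhds 0) := by
      have := ((hp.sub_const d).norm.mul hq'.norm).add ((hq'.sub_const (q t)).norm.const_mul ‖d‖)
      simpa using this
    rw [tendsto_iff_norm_sub_tendsto_zero]
    refine squeeze_zero (fun _ => norm_nonneg _) (fun s => ?_) h1
    have h2 : slope p t s (q s) - d (q t) = (slope p t s - d) (q s) + d (q s - q t) := by
      rw [sub_apply, map_sub]
      ring
    rw [h2]
    exact (norm_add_le _ _).trans
      (add_le_add (ContinuousLinearMap.le_opNorm _ _) (ContinuousLinearMap.le_opNorm _ _))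
  refine ((Complex.continuous_re.tendsto _).comp h).congr fun s => ?_
  rw [Function.comp_apply, slope_def_module, slope_def_module, hf, smul_apply, Complex.smul_re]

theorem toHneg1_sub_apply (a b v : H1per L) :
    (toHneg1 a - toHneg1 b) v = inner ℂ (toL2 v) (toL2 (a - b)) := by
  rw [map_sub, inner_sub_right]
  rfl

theorem hasDerivWithinAt_norm_sq_toL2 {u : ℝ → H1per L} {I : Set ℝ} {t : ℝ} {d : Hneg1per L}
    (hu : HasDerivWithinAt (fun s => toHneg1 (u s)) d I t) (hc : ContinuousWithinAt u I t) :
    HasDerivWithinAt (fun s => ‖toL2 (u s)‖ ^ 2) (2 * (d (u t)).re) I t := by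
  have h := hasDerivWithinAt_of_pairing (f := fun s => ‖toL2 (u s)‖ ^ 2)
    (q := fun s => u s + u t) (fun s => ?_) hu (hc.add continuousWithinAt_const)
  · refine h.congr_deriv ?_
    rw [map_add, Complex.add_re]
    ring
  · rw [toHneg1_sub_apply, map_add, map_sub, inner_add_left, inner_sub_right, inner_sub_right]
    simp only [Complex.add_re, Complex.sub_re]
    have h1 : (inner ℂ (toL2 (u t)) (toL2 (u s))).re = (inner ℂ (toL2 (u s)) (toL2 (u t))).re := by
      rw [← inner_conj_symm, Complex.conj_re]
    have h2 : ∀ v : L2per L, (inner ℂ v v).re = ‖v‖ ^ 2 := fun v => by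
      rw [inner_self_eq_ofReal, Complex.ofReal_re]
    rw [h1, h2, h2]
    ring

theorem integral_norm_sq_L2per (f : L2per L) : ∫ x, ‖f x‖ ^ 2 = ‖f‖ ^ 2 := by
  have h4 := congrArg Complex.re (@L2.inner_def (AddCircle (2 * L)) ℂ ℂ _ _ _ _ _ f f)
  have h5 : (∫ a, inner ℂ (f a) (f a)) = ((∫ a, ‖f a‖ ^ 2 : ℝ) : ℂ) := by
    rw [← integral_complex_ofReal]
    refine integral_congr_ae (Filter.Eventually.of_forall fun a => ?_)
    simp [inner_self_eq_norm_sq_to_K]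
  rw [h5, inner_self_eq_norm_sq_to_K] at h4
  rw [← Complex.ofReal_re (∫ a, ‖f a‖ ^ 2), ← h4]
  norm_cast

theorem charge_eq (u : H1per L) : charge u = 1 / 2 * ‖toL2 u‖ ^ 2 := by
  rw [charge, integral_norm_sq_L2per]

/-- The quartic part `∫ |u|⁴` of the energy. -/
def quartic (u : H1per L) : ℝ := ∫ x, ‖toCont u x‖ ^ 4

theorem quartic_eq (u : H1per L) : quartic u = ‖mulL2 (toCont u) (toL2 u)‖ ^ 2 := by
  rw [quartic, ← integral_norm_sq_L2per]
  refine integral_congr_ae ?_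
  filter_upwards [coeFn_mulL2 (toCont u) (toL2 u), toCont_ae_eq u] with x h1 h2
  rw [h1, ← h2, norm_mul]
  ring

theorem quartic_le (u : H1per L) : quartic u ≤ ‖toCont u‖ ^ 2 * ‖toL2 u‖ ^ 2 := by
  rw [quartic_eq, ← mul_pow]
  exact pow_le_pow_left₀ (norm_nonneg _) (norm_mulL2_le _ _) 2

theorem quartic_nonneg (u : H1per L) : 0 ≤ quartic u := by
  rw [quartic_eq]
  positivity

theorem continuous_quartic : Continuous (quartic (L := L)) := by
  simp_rw [funext quartic_eq]
  fun_prop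

theorem energy_eq_quartic (Z : ℝ) (u : H1per L) : energy Z u
    = 1 / 2 * ‖dx u‖ ^ 2 - Z / 2 * ‖toCont u 0‖ ^ 2 - 1 / 4 * quartic u := by
  rw [energy, integral_norm_sq_L2per, quartic]

theorem energy_eq_form (Z l : ℝ) (u : H1per L) : energy Z u
    = 1 / 2 * (inner ℂ (formOp Z l u) u).re - l * charge u - 1 / 4 * quartic u := by
  rw [energy_eq_quartic, charge_eq, ← inner_conj_symm, Complex.conj_re, re_inner_formOp_self]
  ring

theorem continuous_charge : Continuous (charge (L := L)) := by
  simp_rw [funext charge_eq]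
  fun_prop

theorem continuous_energy (Z : ℝ) : Continuous (energy (L := L) Z) := by
  simp_rw [funext (energy_eq_quartic Z)]
  have h1 : Continuous fun u : H1per L => toCont u 0 := evalZero.continuous
  have h2 := continuous_quartic (L := L)
  fun_prop

/-- A symmetric factor for the increments of `∫ |u|⁴`; on the diagonal it is `4 |u|² u`. -/
def quarticFactor (u v : H1per L) : H1per L :=
  mulH1 (u + v) (mulH1 u (conjH1 u) + mulH1 v (conjH1 v))

theorem norm_pow_four_sub (a b : ℂ) : ‖a‖ ^ 4 - ‖b‖ ^ 4
    = ((a - b) * conj ((a + b) * (a * conj a + b * conj b))).re := by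
  have h : ∀ z : ℂ, ‖z‖ ^ 4 = (z.re * z.re + z.im * z.im) ^ 2 := fun z => by
    rw [← Complex.normSq_apply, Complex.normSq_eq_norm_sq]
    ring
  rw [h, h]
  simp
  ring

theorem integrable_continuousMap {F : Type*} [NormedAddCommGroup F]
    {f : AddCircle (2 * L) → F} (hf : Continuous f) : Integrable f volume :=
  hf.integrable_of_hasCompactSupport (HasCompactSupport.of_compactSpace f)

theorem quartic_sub (u v : H1per L) : quartic u - quartic v
    = (inner ℂ (toL2 (quarticFactor u v)) (toL2 (u - v))).re := by
  have h1 : inner ℂ (toL2 (quarticFactor u v)) (toL2 (u - v))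
      = ∫ x, toCont (u - v) x * conj (toCont (quarticFactor u v) x) := by
    rw [L2.inner_def]
    refine integral_congr_ae ?_
    filter_upwards [toCont_ae_eq (quarticFactor u v), toCont_ae_eq (u - v)] with x h1 h2
    rw [← h1, ← h2, RCLike.inner_apply]
  have h2 : (∫ x, toCont (u - v) x * conj (toCont (quarticFactor u v) x)).re
      = ∫ x, (toCont (u - v) x * conj (toCont (quarticFactor u v) x)).re :=
    (integral_re (𝕜 := ℂ) (integrable_continuousMap (by fun_prop))).symm
  rw [h1, h2, quartic, quartic, ← integral_sub (integrable_continuousMap (by fun_prop))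
    (integrable_continuousMap (by fun_prop))]
  refine integral_congr_ae (Filter.Eventually.of_forall fun x => ?_)
  simp only [norm_pow_four_sub, quarticFactor, toCont_mulH1, toCont_conjH1, map_add, map_sub,
    ContinuousMap.mul_apply, ContinuousMap.add_apply, ContinuousMap.sub_apply,
    ContinuousMap.star_apply, Complex.star_def]

theorem quarticFactor_self (u : H1per L) : quarticFactor u u = (4 : ℂ) • cubicH1 u :=
  toCont_injective (by
    simp only [quarticFactor, cubicH1, toCont_mulH1, toCont_conjH1, map_add, map_smul]
    ext x
    simp
    ring)

theorem hasDerivWithinAt_quartic {u : ℝ → H1per L} {I : Set ℝ} {t : ℝ} {d : Hneg1per L}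
    (hu : HasDerivWithinAt (fun s => toHneg1 (u s)) d I t) (hc : Continuous u) :
    HasDerivWithinAt (fun s => quartic (u s)) (4 * (d (cubicH1 (u t))).re) I t := by
  have hq : Continuous fun s => quarticFactor (u s) (u t) := by
    unfold quarticFactor
    refine continuous_mulH1 (hc.add continuous_const) (Continuous.add ?_ continuous_const)
    exact continuous_mulH1 hc (continuous_conjH1.comp hc)
  have h := hasDerivWithinAt_of_pairing (f := fun s => quartic (u s))
    (q := fun s => quarticFactor (u s) (u t)) (fun s => ?_) hu hq.continuousWithinAt
  · refine h.congr_deriv ?_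
    rw [quarticFactor_self, map_smulₛₗ]
    simp
  · rw [quartic_sub, toHneg1_sub_apply]

/-- The nonlinear term of the equation, with the shift `l` of the linear part compensated. -/
def nlin (l : ℝ) (u : H1per L) : H1per L := cubicH1 u + (l : ℂ) • u

theorem exists_norm_nlin_sub_le (l R : ℝ) : ∃ C, ∀ u v : H1per L, ‖u‖ ≤ R → ‖v‖ ≤ R →
    ‖nlin l u - nlin l v‖ ≤ C * ‖u - v‖ := by
  obtain ⟨C, hC⟩ := exists_norm_cubicH1_sub_le (L := L) R
  refine ⟨C + |l|, fun u v hu hv => ?_⟩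
  have h : nlin l u - nlin l v = (cubicH1 u - cubicH1 v) + (l : ℂ) • (u - v) := by
    simp only [nlin]
    module
  rw [h, add_mul]
  refine (norm_add_le _ _).trans (add_le_add (hC u v hu hv) ?_)
  rw [norm_smul, Complex.norm_real, Real.norm_eq_abs]

theorem hasDerivAt_toHneg1 {u : ℝ → H1per L} {d : H1per L} {t : ℝ}
    (h : HasDerivAt (fun s => massOp (u s)) d t) :
    HasDerivAt (fun s => toHneg1 (u s)) (riesz d) t := by
  simp_rw [toHneg1_eq]
  exact (riesz.restrictScalars ℝ).hasFDerivAt.comp_hasDerivAt t h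

theorem im_inner_formOp_self (Z l : ℝ) (u : H1per L) : (inner ℂ u (formOp Z l u)).im = 0 := by
  rw [← Complex.conj_eq_iff_im, inner_conj_symm]
  exact ContinuousLinearMap.isSelfAdjoint_iff_isSymmetric.1 (isSelfAdjoint_formOp Z l) u u

theorem inner_toL2_cubicH1 (u : H1per L) :
    inner ℂ (toL2 u) (toL2 (cubicH1 u)) = (quartic u : ℂ) := by
  rw [L2.inner_def, quartic, ← integral_complex_ofReal]
  refine integral_congr_ae ?_
  filter_upwards [toCont_ae_eq u, toCont_ae_eq (cubicH1 u)] with x h1 h2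
  rw [← h1, ← h2, toCont_cubicH1, RCLike.inner_apply]
  change (‖toCont u x‖ : ℂ) ^ 2 * toCont u x * conj (toCont u x) = _
  rw [mul_assoc, Complex.mul_conj']
  push_cast
  ring

theorem im_inner_massOp_nlin (l : ℝ) (u : H1per L) :
    (inner ℂ u (massOp (nlin l u))).im = 0 := by
  rw [inner_massOp, nlin, map_add, map_smul, inner_add_right, inner_smul_right, inner_toL2_cubicH1,
    inner_self_eq_ofReal, ← Complex.ofReal_mul, ← Complex.ofReal_add, Complex.ofReal_im]

theorem hasDerivAt_charge {Z l : ℝ} {u : ℝ → H1per L} {t : ℝ} (hc : Continuous u)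
    (hd : HasDerivAt (fun s => massOp (u s))
      (-Complex.I • formOp Z l (u t) + Complex.I • massOp (nlin l (u t))) t) :
    HasDerivAt (fun s => charge (u s)) 0 t := by
  simp_rw [charge_eq]
  have h := (hasDerivWithinAt_norm_sq_toL2 (I := univ)
    (hasDerivAt_toHneg1 hd).hasDerivWithinAt hc.continuousWithinAt).const_mul (1 / 2)
  rw [hasDerivWithinAt_univ] at h
  refine h.congr_deriv ?_
  rw [riesz_apply, inner_add_right, inner_smul_right, inner_smul_right]
  simp [im_inner_formOp_self, im_inner_massOp_nlin]

theorem hasDerivAt_energy {Z l : ℝ} {u : ℝ → H1per L} {t : ℝ} (hc : Continuous u)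
    (hd : HasDerivAt (fun s => massOp (u s))
      (-Complex.I • formOp Z l (u t) + Complex.I • massOp (nlin l (u t))) t)
    (hf : HasDerivAt (fun s => (inner ℂ (formOp Z l (u s)) (u s)).re)
      (2 * (inner ℂ (formOp Z l (u t)) (Complex.I • nlin l (u t))).re) t) :
    HasDerivAt (fun s => energy Z (u s)) 0 t := by
  simp_rw [energy_eq_form Z l, charge_eq]
  have hd' := (hasDerivAt_toHneg1 hd).hasDerivWithinAt (s := univ)
  have h1 := hasDerivWithinAt_norm_sq_toL2 hd' hc.continuousWithinAt
  have h2 := hasDerivWithinAt_quartic hd' hc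
  rw [hasDerivWithinAt_univ] at h1 h2
  refine (((hf.const_mul (1 / 2)).sub ((h1.const_mul (1 / 2)).const_mul l)).sub
    (h2.const_mul (1 / 4))).congr_deriv ?_
  set d := -Complex.I • formOp Z l (u t) + Complex.I • massOp (nlin l (u t)) with hdd
  -- The pairing of the time derivative with `nlin` cancels the derivative of the quadratic form.
  have h3 : (riesz d (nlin l (u t))).re
      = (riesz d (cubicH1 (u t))).re + l * (riesz d (u t)).re := by
    conv_lhs => rw [nlin]
    rw [map_add, map_smulₛₗ]
    simp
  have h4 : (riesz d (nlin l (u t))).re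
      = (inner ℂ (formOp Z l (u t)) (Complex.I • nlin l (u t))).re := by
    have h5 : inner ℂ (nlin l (u t)) (formOp Z l (u t))
        = conj (inner ℂ (formOp Z l (u t)) (nlin l (u t))) := (inner_conj_symm _ _).symm
    rw [riesz_apply, hdd, inner_add_right, inner_smul_right, inner_smul_right, inner_smul_right,
      inner_massOp, inner_self_eq_ofReal, h5]
    simp [-Complex.ofReal_pow, -inner_conj_symm]
  linarith

/-! ### The a priori bound and global solutions -/

/-- Charge and energy control the `H¹` norm: by interpolation the focusing terms cost a small
multiple of the squared norm. -/
theorem exists_apriori_bound (Z r : ℝ) : ∃ R, 0 < R ∧ ∀ u₀ u : H1per L, ‖u₀‖ ≤ r →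
    energy Z u = energy Z u₀ → charge u = charge u₀ → ‖u‖ < R := by
  set A : ℝ := |Z| + r ^ 2 / 2 + 1 with hA
  have hA0 : 0 < A := by positivity
  obtain ⟨C, hC, hb⟩ := exists_norm_toCont_sq_le (L := L) (ε := 1 / (2 * A)) (by positivity)
  set k : ℝ := ‖toCont (L := L)‖ with hk
  set D : ℝ := 2 * (r ^ 2 + (r ^ 2 + |Z| * (k * r) ^ 2) + A * (C * r ^ 2)) with hD
  have hD0 : 0 ≤ D := by positivity
  refine ⟨√D + 1, by positivity, fun u₀ u hr hE hQ => ?_⟩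
  have hm0 : ‖toL2 u₀‖ ^ 2 ≤ r ^ 2 :=
    pow_le_pow_left₀ (norm_nonneg _) ((norm_toL2_le u₀).trans hr) 2
  have hd0 : ‖dx u₀‖ ^ 2 ≤ r ^ 2 :=
    pow_le_pow_left₀ (norm_nonneg _) ((norm_dx_le u₀).trans hr) 2
  have hm : ‖toL2 u‖ ^ 2 ≤ r ^ 2 := by
    rw [charge_eq, charge_eq] at hQ
    linarith
  have h0 : ∀ v : H1per L, ‖toCont v 0‖ ^ 2 ≤ ‖toCont v‖ ^ 2 := fun v =>
    pow_le_pow_left₀ (norm_nonneg _) ((toCont v).norm_coe_le_norm 0) 2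
  have hs0 : ‖toCont u₀‖ ^ 2 ≤ (k * r) ^ 2 :=
    pow_le_pow_left₀ (norm_nonneg _) ((toCont.le_opNorm u₀).trans (by gcongr)) 2
  rw [energy_eq_quartic, energy_eq_quartic] at hE
  have hZ0 : -Z * ‖toCont u₀ 0‖ ^ 2 ≤ |Z| * (k * r) ^ 2 :=
    mul_le_mul (neg_le_abs Z) ((h0 u₀).trans hs0) (sq_nonneg _) (abs_nonneg _)
  have hZ : Z * ‖toCont u 0‖ ^ 2 ≤ |Z| * ‖toCont u‖ ^ 2 :=
    mul_le_mul (le_abs_self Z) (h0 u) (sq_nonneg _) (abs_nonneg _)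
  have hq : quartic u ≤ ‖toCont u‖ ^ 2 * r ^ 2 :=
    (quartic_le u).trans (mul_le_mul_of_nonneg_left hm (sq_nonneg _))
  have hq0 := quartic_nonneg u₀
  have hAb : A * ‖toCont u‖ ^ 2 ≤ 1 / 2 * ‖u‖ ^ 2 + A * (C * r ^ 2) := by
    have h1 : A * ‖toCont u‖ ^ 2 ≤ A * (1 / (2 * A) * ‖u‖ ^ 2 + C * r ^ 2) :=
      mul_le_mul_of_nonneg_left ((hb u).trans (by gcongr)) hA0.le
    have h2 : A * (1 / (2 * A) * ‖u‖ ^ 2) = 1 / 2 * ‖u‖ ^ 2 := by field_simp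
    linarith
  have hu := norm_sq_H1per u
  have hexp : A * ‖toCont u‖ ^ 2
      = |Z| * ‖toCont u‖ ^ 2 + 1 / 2 * (‖toCont u‖ ^ 2 * r ^ 2) + ‖toCont u‖ ^ 2 := by
    rw [hA]
    ring
  have hfin : ‖u‖ ^ 2 ≤ D := by
    rw [hD]
    linarith [sq_nonneg ‖toCont u‖]
  have := Real.le_sqrt_of_sq_le hfin
  linarith

/-- For every initial value there is a global solution in interaction variables, which conserves
energy and charge. It solves the truncated equation for a truncation radius that it never
reaches. -/
theorem exists_conservative_flow {Z l : ℝ} {S : ℝ → H1per L →L[ℂ] H1per L}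
    (hS : IsFormGroup massOp (formOp Z l) S) (u₀ : H1per L) :
    ∃ w : ℝ → H1per L, w 0 = u₀ ∧ (∀ t, HasDerivAt w (interaction S (nlin l) t (w t)) t) ∧
      ∀ t, energy Z (S t (w t)) = energy Z u₀ ∧ charge (S t (w t)) = charge u₀ := by
  obtain ⟨R, hR, hb⟩ := exists_apriori_bound (L := L) Z ‖u₀‖
  obtain ⟨M, hM⟩ := hS.bounded
  obtain ⟨w, hw0, hw⟩ := exists_truncated_flow hM hS.cont (exists_norm_nlin_sub_le l) hR u₀
  have hc := hS.continuous_mild hw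
  have hS0 : S 0 (w 0) = u₀ := by rw [hS.zero, hw0]; rfl
  have hcons : ∀ t, (energy Z (S t (w t)), charge (S t (w t))) = (energy Z u₀, charge u₀)
      ∧ ‖S t (w t)‖ < R := by
    intro t
    have h := eq_and_lt_of_hasDerivAt_zero (f := fun t => ‖S t (w t)‖)
      (e := fun t => (energy Z (S t (w t)), charge (S t (w t)))) (R := R) hc.norm
      (((continuous_energy Z).comp hc).prodMk (continuous_charge.comp hc)) (fun t ht => ?_)
      (fun t ht => ?_) t
    · rwa [hS0] at h
    · have h1 := hS.hasDerivAt_mild hw t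
      have h2 := hS.hasDerivAt_form hw (isSelfAdjoint_formOp Z l) t
      simp only [radial_of_norm_le hR ht] at h1 h2
      exact (hasDerivAt_energy hc h1 h2).prodMk (hasDerivAt_charge hc h1)
    · rw [hS0, Prod.mk.injEq] at ht
      exact hb u₀ _ le_rfl ht.1 ht.2
  refine ⟨w, hw0, fun t => ?_, fun t => Prod.mk.inj (hcons t).1⟩
  have h := hw t
  rwa [interaction, radial_of_norm_le hR (hcons t).2.le] at h

theorem isSolutionOn_of_hasDerivAt {Z l : ℝ} {u : ℝ → H1per L} (hc : Continuous u)
    (hd : ∀ t, HasDerivAt (fun s => massOp (u s))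
      (-Complex.I • formOp Z l (u t) + Complex.I • massOp (nlin l (u t))) t) :
    IsSolutionOn Z univ u := by
  have hw : ∀ t, riesz (-Complex.I • formOp Z l (u t) + Complex.I • massOp (nlin l (u t)))
      = Complex.I • (dxx (u t) + (Z : ℂ) • diracMul (u t) + cubicHneg1 (u t)) := by
    intro t
    rw [dxx_add_diracMul Z l, cubicHneg1_eq, nlin]
    simp only [map_add, map_sub, map_smul]
    module
  refine ⟨hc.continuousOn, fun t => riesz (-Complex.I • formOp Z l (u t)
    + Complex.I • massOp (nlin l (u t))), ?_, fun t _ =>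
    ⟨(hasDerivAt_toHneg1 (hd t)).hasDerivWithinAt, ?_⟩⟩
  · have h1 : Continuous fun t => cubicH1 (u t) :=
      continuous_mulH1 (continuous_mulH1 hc (continuous_conjH1.comp hc)) hc
    have h0 : Continuous fun t => (l : ℂ) • u t := (continuous_const_smul (l : ℂ)).comp hc
    have h2 : Continuous fun t => nlin l (u t) := h1.add h0
    have h3 : Continuous fun t => massOp (nlin l (u t)) := massOp.continuous.comp h2
    have h4 : Continuous fun t => formOp Z l (u t) := (formOp Z l).continuous.comp hc
    have h5 : Continuous fun t => -Complex.I • formOp Z l (u t) + Complex.I • massOp (nlin l (u t)) :=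
      ((continuous_const_smul (-Complex.I)).comp h4).add
        ((continuous_const_smul Complex.I).comp h3)
    exact (riesz.continuous.comp h5).continuousOn
  · beta_reduce
    rw [hw, smul_smul, Complex.I_mul_I]
    module

end Conservation

/-! ### Uniqueness -/

section Uniqueness

variable {L : ℝ} [Fact (0 < L)]

theorem eq_zero_of_abs_deriv_le_mul {y y' : ℝ → ℝ} {K T : ℝ}
    (hy : ∀ t ∈ Icc (-T) T, HasDerivWithinAt y (y' t) (Icc (-T) T) t)
    (hb : ∀ t ∈ Icc (-T) T, |y' t| ≤ K * |y t|) (h0 : y 0 = 0) :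
    ∀ t ∈ Icc (-T) T, y t = 0 := by
  have hneg : ∀ t ∈ Icc (-T) T, -t ∈ Icc (-T) T := fun t ht => ⟨by linarith [ht.2], by linarith [ht.1]⟩
  have key : ∀ {y y' : ℝ → ℝ}, (∀ t ∈ Icc (-T) T, HasDerivWithinAt y (y' t) (Icc (-T) T) t) →
      (∀ t ∈ Icc (-T) T, |y' t| ≤ K * |y t|) → y 0 = 0 → ∀ t ∈ Icc 0 T, y t = 0 := by
    intro y y' hy hb h0
    have hsub : Icc 0 T ⊆ Icc (-T) T := fun t ht => ⟨by linarith [ht.1, ht.2], ht.2⟩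
    refine eq_zero_of_abs_deriv_le_mul_abs_self_of_eq_zero_right (f' := y') (K := K)
      (fun t ht => ((hy t (hsub ht)).continuousWithinAt).mono hsub) (fun t ht => ?_) h0
      fun t ht => hb t (hsub (Ico_subset_Icc_self ht))
    refine (hy t (hsub (Ico_subset_Icc_self ht))).mono_of_mem_nhdsWithin ?_
    exact Filter.mem_of_superset (Icc_mem_nhdsGE ht.2) (Icc_subset_Icc_left (by linarith [ht.1, ht.2]))
  intro t ht
  rcases le_total 0 t with h | h
  · exact key hy hb h0 t ⟨h, ht.2⟩
  · have hy2 : ∀ t ∈ Icc (-T) T,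
        HasDerivWithinAt (fun s => y (-s)) (-y' (-t)) (Icc (-T) T) t := by
      intro t ht
      have := (hy (-t) (hneg t ht)).scomp t (hasDerivAt_neg t).hasDerivWithinAt hneg
      simpa [Function.comp_def] using this
    have := key (y := fun s => y (-s)) hy2
      (fun t ht => by rw [abs_neg]; exact hb (-t) (hneg t ht)) (by rwa [neg_zero]) (-t)
      ⟨by linarith, by linarith [ht.1]⟩
    rwa [neg_neg] at this

theorem norm_toL2_cubicH1_sub_le {u v : H1per L} {m : ℝ} (hu : ‖toCont u‖ ≤ m)
    (hv : ‖toCont v‖ ≤ m) :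
    ‖toL2 (cubicH1 u - cubicH1 v)‖ ≤ 3 * m ^ 2 * ‖toL2 (u - v)‖ := by
  have hm : 0 ≤ m := (norm_nonneg _).trans hu
  have hmul : ∀ a b : H1per L, ‖toL2 (mulH1 a b)‖ ≤ ‖toCont a‖ * ‖toL2 b‖ := fun a b =>
    norm_mulL2_le _ _
  have hconj : ‖toL2 (conjH1 (u - v))‖ = ‖toL2 (u - v)‖ := norm_conjL2 _
  have h1 : ‖toCont (mulH1 (u + v) (conjH1 u))‖ ≤ (m + m) * m := by
    rw [toCont_mulH1, toCont_conjH1, map_add]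
    refine (norm_mul_le _ _).trans ?_
    rw [norm_star]
    exact mul_le_mul ((norm_add_le _ _).trans (add_le_add hu hv)) hu (norm_nonneg _) (by positivity)
  have h2 : ‖toCont (mulH1 v v)‖ ≤ m * m := by
    rw [toCont_mulH1]
    exact (norm_mul_le _ _).trans (mul_le_mul hv hv (norm_nonneg _) hm)
  rw [cubicH1_sub, map_add]
  calc _ ≤ _ := norm_add_le _ _
    _ ≤ (m + m) * m * ‖toL2 (u - v)‖ + m * m * ‖toL2 (u - v)‖ := by
        refine add_le_add ((hmul _ _).trans (by gcongr)) ((hmul _ _).trans ?_)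
        rw [hconj]
        gcongr
    _ = _ := by ring

theorem im_dxx_add_diracMul_self (Z : ℝ) (z : H1per L) :
    ((dxx z + (Z : ℂ) • diracMul z) z).im = 0 := by
  rw [dxx_add_diracMul Z 0, riesz_apply, Complex.ofReal_zero, zero_smul, zero_sub, inner_neg_right,
    Complex.neg_im, im_inner_formOp_self, neg_zero]

/-- Two solutions with the same initial value agree: the squared `L²` norm of the difference
satisfies a linear differential inequality, since the linear part of the equation is symmetric and
the cubic term is Lipschitz in `L²` on sets that are bounded in the supremum norm. -/
theorem IsSolutionOn.eqOn {Z T : ℝ} {u v : ℝ → H1per L} (hu : IsSolutionOn Z (Icc (-T) T) u)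
    (hv : IsSolutionOn Z (Icc (-T) T) v) (h0 : u 0 = v 0) : EqOn u v (Icc (-T) T) := by
  obtain ⟨huc, du, -, hud⟩ := hu
  obtain ⟨hvc, dv, -, hvd⟩ := hv
  have hbdd : ∀ {u : ℝ → H1per L}, ContinuousOn u (Icc (-T) T) →
      ∃ m, ∀ t ∈ Icc (-T) T, ‖toCont (u t)‖ ≤ m := fun hc =>
    isCompact_Icc.exists_bound_of_continuousOn (toCont.continuous.comp_continuousOn hc)
  obtain ⟨mu, hmu⟩ := hbdd huc
  obtain ⟨mv, hmv⟩ := hbdd hvc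
  set m := max mu mv
  have hz : ∀ t ∈ Icc (-T) T, HasDerivWithinAt (fun s => ‖toL2 (u s - v s)‖ ^ 2)
      (2 * ((du t - dv t) (u t - v t)).re) (Icc (-T) T) t := by
    intro t ht
    refine hasDerivWithinAt_norm_sq_toL2 ?_ ((huc.sub hvc) t ht)
    refine ((hud t ht).1.sub (hvd t ht).1).congr_deriv rfl |>.congr_of_mem (fun s _ => ?_) ht
    rw [toHneg1_eq, map_sub, map_sub, ← toHneg1_eq, ← toHneg1_eq]
    rfl
  have hzero := eq_zero_of_abs_deriv_le_mul (K := 2 * (3 * m ^ 2)) hz (fun t ht => ?_)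
    (by simp [h0])
  · intro t ht
    have h := hzero t ht
    rw [sq_eq_zero_iff, norm_eq_zero] at h
    exact sub_eq_zero.1 (toL2_injective (h.trans (map_zero _).symm))
  · set z := u t - v t with hzdef
    have hlin : dxx z + (Z : ℂ) • diracMul z
        = (dxx (u t) + (Z : ℂ) • diracMul (u t)) - (dxx (v t) + (Z : ℂ) • diracMul (v t)) := by
      simp only [dxx_add_diracMul Z 0, ← map_sub]
      refine congrArg (riesz (L := L)) ?_
      rw [hzdef, map_sub, map_sub]
      module
    have hcub : (cubicHneg1 (u t) - cubicHneg1 (v t)) z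
        = inner ℂ (toL2 z) (toL2 (cubicH1 (u t) - cubicH1 (v t))) := by
      rw [← toHneg1_sub_apply, cubicHneg1_eq, cubicHneg1_eq, toHneg1_eq, toHneg1_eq]
    have heq : Complex.I • (du t - dv t)
        = -((dxx z + (Z : ℂ) • diracMul z) + (cubicHneg1 (u t) - cubicHneg1 (v t))) := by
      have h1 := (hud t ht).2
      have h2 := (hvd t ht).2
      rw [hlin, ← sub_eq_zero]
      refine Eq.trans ?_ ((congrArg₂ (· - ·) h1 h2).trans (sub_self 0))
      module
    have heq' := congrArg (fun p : Hneg1per L => (p z).im) heq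
    have h1 : ((Complex.I • (du t - dv t)) z).im = ((du t - dv t) z).re := by
      rw [smul_apply, smul_eq_mul, Complex.I_mul_im]
    beta_reduce at heq'
    rw [h1, neg_apply, add_apply, hcub, Complex.neg_im, Complex.add_im,
      im_dxx_add_diracMul_self, zero_add] at heq'
    rw [heq', abs_mul, abs_neg, abs_two, abs_of_nonneg (sq_nonneg ‖toL2 z‖), mul_assoc]
    refine mul_le_mul_of_nonneg_left ?_ two_pos.le
    refine (Complex.abs_im_le_norm _).trans ((norm_inner_le_norm _ _).trans ?_)
    have h2 := norm_toL2_cubicH1_sub_le ((hmu t ht).trans (le_max_left mu mv))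
      ((hmv t ht).trans (le_max_right mu mv))
    calc ‖toL2 z‖ * ‖toL2 (cubicH1 (u t) - cubicH1 (v t))‖
        ≤ ‖toL2 z‖ * (3 * m ^ 2 * ‖toL2 z‖) := mul_le_mul_of_nonneg_left h2 (norm_nonneg _)
      _ = _ := by ring

theorem IsSolutionOn.mono {Z : ℝ} {I J : Set ℝ} {u : ℝ → H1per L} (hu : IsSolutionOn Z I u)
    (h : J ⊆ I) : IsSolutionOn Z J u := by
  obtain ⟨hc, w, hw, hd⟩ := hu
  exact ⟨hc.mono h, w, hw.mono h, fun t ht => ⟨(hd t (h ht)).1.mono h, (hd t (h ht)).2⟩⟩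

/-! ### Reflection of solutions -/

theorem reflL2_reflL2 (f : L2per L) : reflL2 (reflL2 f) = f := by
  refine Lp.ext ?_
  filter_upwards [coeFn_reflL2 (reflL2 f),
    measurePreserving_neg.quasiMeasurePreserving.ae (coeFn_reflL2 f)] with x h1 h2
  rw [h1, h2, neg_neg]

theorem inner_reflL2 (f g : L2per L) : inner ℂ f (reflL2 g) = inner ℂ (reflL2 f) g := by
  have h := (Lp.compMeasurePreservingₗᵢ ℂ (fun x : AddCircle (2 * L) => -x)
    measurePreserving_neg (E := ℂ) (p := 2)).inner_map_map (reflL2 f) g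
  change inner ℂ (reflL2 (reflL2 f)) (reflL2 g) = _ at h
  rwa [reflL2_reflL2] at h

theorem toHneg1_reflH1 (u : H1per L) : toHneg1 (reflH1 u) = (toHneg1 u).comp reflH1 := by
  ext v
  exact inner_reflL2 (toL2 v) (toL2 u)

theorem dxx_reflH1 (u : H1per L) : dxx (reflH1 u) = (dxx u).comp reflH1 := by
  ext v
  have h1 : dxx (reflH1 u) v = -inner ℂ (dx v) (dx (reflH1 u)) := rfl
  have h2 : (dxx u).comp reflH1 v = -inner ℂ (dx (reflH1 v)) (dx u) := rfl
  rw [h1, h2, dx_reflH1, dx_reflH1, inner_neg_right, inner_neg_left, inner_reflL2]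

theorem diracMul_reflH1 (u : H1per L) : diracMul (reflH1 u) = (diracMul u).comp reflH1 := by
  ext v
  rw [ContinuousLinearMap.comp_apply, diracMul_apply, diracMul_apply, toCont_reflH1, toCont_reflH1,
    reflCont_apply, reflCont_apply, neg_zero]

theorem cubicH1_reflH1 (u : H1per L) : cubicH1 (reflH1 u) = reflH1 (cubicH1 u) :=
  toCont_injective (by
    ext x
    simp [cubicH1])

theorem cubicHneg1_reflH1 (u : H1per L) : cubicHneg1 (reflH1 u) = (cubicHneg1 u).comp reflH1 := by
  rw [cubicHneg1_eq, cubicHneg1_eq, cubicH1_reflH1, ← toHneg1_eq, ← toHneg1_eq, toHneg1_reflH1]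

theorem IsSolutionOn.reflH1 {Z : ℝ} {I : Set ℝ} {u : ℝ → H1per L} (hu : IsSolutionOn Z I u) :
    IsSolutionOn Z I fun t => reflH1 (u t) := by
  obtain ⟨hc, w, hw, hd⟩ := hu
  let P : Hneg1per L →L[ℂ] Hneg1per L :=
    (ContinuousLinearMap.compSL (H1per L) (H1per L) ℂ (RingHom.id ℂ) (starRingEnd ℂ)).flip
      PeriodicNLS.reflH1
  have hP : ∀ p, P p = p.comp PeriodicNLS.reflH1 := fun p => rfl
  refine ⟨PeriodicNLS.reflH1.continuous.comp_continuousOn hc, fun t => P (w t),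
    P.continuous.comp_continuousOn hw, fun t ht => ⟨?_, ?_⟩⟩
  · have h := (P.restrictScalars ℝ).hasFDerivAt.comp_hasDerivWithinAt t (hd t ht).1
    refine (h.congr_deriv rfl).congr_of_mem (fun s _ => ?_) ht
    exact toHneg1_reflH1 (u s)
  · have h := congrArg P (hd t ht).2
    rw [map_zero, map_add, map_add, map_add, map_smul, map_smul] at h
    rw [dxx_reflH1, diracMul_reflH1, cubicHneg1_reflH1]
    exact h

theorem isEven_iff (u : H1per L) : IsEven u ↔ reflH1 u = u := by
  rw [← toCont_injective.eq_iff, toCont_reflH1, ContinuousMap.ext_iff]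
  rfl

/-! ### Continuous dependence on the initial value -/

/-- The flow is Lipschitz in the initial value, uniformly among solutions that stay in a given
ball. -/
theorem exists_norm_mild_sub_le {l M R : ℝ} {S : ℝ → H1per L →L[ℂ] H1per L} (hM : ∀ t, ‖S t‖ ≤ M) :
    ∃ C : NNReal, ∀ w w' : ℝ → H1per L, (∀ t, HasDerivAt w (interaction S (nlin l) t (w t)) t) →
      (∀ t, HasDerivAt w' (interaction S (nlin l) t (w' t)) t) → (∀ t, ‖S t (w t)‖ ≤ R) →
      (∀ t, ‖S t (w' t)‖ ≤ R) → ∀ t,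
      dist (S t (w t)) (S t (w' t)) ≤ M * (dist (w 0) (w' 0) * Real.exp (C * |t|)) := by
  obtain ⟨C, hC⟩ := exists_norm_nlin_sub_le (L := L) l R
  have hM0 : 0 ≤ M := (norm_nonneg _).trans (hM 0)
  have hSle : ∀ t x, ‖S t x‖ ≤ M * ‖x‖ := fun t x =>
    ((S t).le_opNorm x).trans (mul_le_mul_of_nonneg_right (hM t) (norm_nonneg _))
  refine ⟨⟨M * (|C| * M), by positivity⟩, fun w w' hw hw' hb hb' t => ?_⟩
  have hlip : ∀ t, LipschitzOnWith ⟨M * (|C| * M), by positivity⟩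
      (interaction S (nlin l) t) {x | ‖S t x‖ ≤ R} := by
    intro t
    refine LipschitzOnWith.of_dist_le_mul fun x hx y hy => ?_
    rw [dist_eq_norm, dist_eq_norm, interaction, interaction, ← smul_sub, norm_smul,
      Complex.norm_I, one_mul, ← map_sub]
    refine (hSle _ _).trans ?_
    have h1 := hC (S t x) (S t y) hx hy
    have h2 := hSle t (x - y)
    rw [map_sub] at h2
    calc M * ‖nlin l (S t x) - nlin l (S t y)‖
        ≤ M * (|C| * (M * ‖x - y‖)) := by
          refine mul_le_mul_of_nonneg_left (h1.trans ?_) hM0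
          exact mul_le_mul (le_abs_self C) h2 (norm_nonneg _) (abs_nonneg _)
      _ = M * (|C| * M) * ‖x - y‖ := by ring
  have h := dist_le_of_hasDerivAt_of_lipschitzOnWith hlip hw hb hw' hb' t
  refine le_trans ?_ (mul_le_mul_of_nonneg_left h hM0)
  rw [dist_eq_norm, dist_eq_norm, ← map_sub]
  exact hSle t _

theorem continuous_restrict_of_dist_le {E : Type*} [NormedAddCommGroup E] {Φ : E → C(ℝ, E)} {T : ℝ}
    (hΦ : ∀ r, ∃ C : ℝ, ∀ x y, ‖x‖ ≤ r → ‖y‖ ≤ r → ∀ t ∈ Icc (-T) T,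
      dist (Φ x t) (Φ y t) ≤ C * dist x y) :
    Continuous fun x => (Φ x).restrict (Icc (-T) T) := by
  rw [continuous_iff_continuousAt]
  intro x
  obtain ⟨C, hC⟩ := hΦ (‖x‖ + 1)
  rw [ContinuousAt, tendsto_iff_dist_tendsto_zero]
  have hlim : Filter.Tendsto (fun y => |C| * dist y x) (nhds x) (nhds 0) := by
    have : Continuous fun y => |C| * dist y x := by fun_prop
    simpa using this.tendsto x
  refine squeeze_zero' (Filter.Eventually.of_forall fun _ => dist_nonneg) ?_ hlim
  filter_upwards [Metric.ball_mem_nhds x one_pos] with y hy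
  rw [ContinuousMap.dist_le (by positivity)]
  rintro ⟨t, ht⟩
  have hy' : ‖y‖ ≤ ‖x‖ + 1 := by
    have := norm_sub_norm_le y x
    rw [Metric.mem_ball, dist_eq_norm] at hy
    linarith
  exact (hC y x hy' (by linarith) t ht).trans
    (mul_le_mul_of_nonneg_right (le_abs_self C) dist_nonneg)

end Uniqueness

end PeriodicNLS

end

theorem proposition4p1 (L : ℝ) [Fact (0 < L)] (Z : ℝ) :
    ∃ Φ : PeriodicNLS.H1per L → C(ℝ, PeriodicNLS.H1per L),
      -- existence on the whole line
      (∀ u₀, Φ u₀ 0 = u₀ ∧ PeriodicNLS.IsSolutionOn Z Set.univ (Φ u₀)) ∧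
      -- uniqueness on every interval `[-T, T]`
      (∀ u₀, ∀ T : ℝ, 0 < T → ∀ v : ℝ → PeriodicNLS.H1per L,
        PeriodicNLS.IsSolutionOn Z (Set.Icc (-T) T) v → v 0 = u₀ →
          Set.EqOn v (Φ u₀) (Set.Icc (-T) T)) ∧
      -- continuous dependence: `u₀ ↦ u ∈ C([-T₀, T₀]; H¹_per)` is continuous
      (∀ T₀ : ℝ, 0 < T₀ → Continuous fun u₀ => (Φ u₀).restrict (Set.Icc (-T₀) T₀)) ∧
      -- conservation of energy and charge
      (∀ u₀ t, PeriodicNLS.energy Z (Φ u₀ t) = PeriodicNLS.energy Z u₀ ∧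
        PeriodicNLS.charge (Φ u₀ t) = PeriodicNLS.charge u₀) ∧
      -- even data give even solutions
      (∀ u₀, PeriodicNLS.IsEven u₀ → ∀ t, PeriodicNLS.IsEven (Φ u₀ t)) := by
  obtain ⟨l, hl⟩ := PeriodicNLS.exists_formOp_coercive (L := L) Z
  obtain ⟨S, hS⟩ := PeriodicNLS.exists_isFormGroup PeriodicNLS.isSelfAdjoint_massOp
    PeriodicNLS.massOp_injective (PeriodicNLS.isSelfAdjoint_formOp Z l) one_half_pos hl
  choose w hw0 hw hcons using PeriodicNLS.exists_conservative_flow hS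
  have hc : ∀ u₀, Continuous fun t => S t (w u₀ t) := fun u₀ => hS.continuous_mild (hw u₀)
  have h0 : ∀ u₀, S 0 (w u₀ 0) = u₀ := fun u₀ => by rw [hS.zero, hw0]; rfl
  have hsol : ∀ u₀, PeriodicNLS.IsSolutionOn Z Set.univ fun t => S t (w u₀ t) := fun u₀ =>
    PeriodicNLS.isSolutionOn_of_hasDerivAt (hc u₀) (hS.hasDerivAt_mild (hw u₀))
  refine ⟨fun u₀ => ⟨fun t => S t (w u₀ t), hc u₀⟩, fun u₀ => ⟨h0 u₀, hsol u₀⟩, ?_, ?_, hcons, ?_⟩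
  · intro u₀ T _ v hv hv0
    exact hv.eqOn ((hsol u₀).mono (Set.subset_univ _)) (hv0.trans (h0 u₀).symm)
  · intro T hT
    refine PeriodicNLS.continuous_restrict_of_dist_le fun r => ?_
    obtain ⟨R, hR, hb⟩ := PeriodicNLS.exists_apriori_bound (L := L) Z r
    obtain ⟨M, hM⟩ := hS.bounded
    obtain ⟨C, hC⟩ := PeriodicNLS.exists_norm_mild_sub_le (l := l) (R := R) hM
    have hM0 : 0 ≤ M := (norm_nonneg _).trans (hM 0)
    have hbd : ∀ u₀, ‖u₀‖ ≤ r → ∀ t, ‖S t (w u₀ t)‖ ≤ R := fun u₀ hr t =>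
      (hb u₀ _ hr (hcons u₀ t).1 (hcons u₀ t).2).le
    refine ⟨M * Real.exp (C * T), fun x y hx hy t ht => ?_⟩
    have h := hC (w x) (w y) (hw x) (hw y) (hbd x hx) (hbd y hy) t
    rw [hw0, hw0] at h
    refine h.trans ?_
    rw [mul_assoc, mul_comm (dist x y)]
    have ht' : |t| ≤ T := abs_le.2 ht
    gcongr
  · intro u₀ he t
    rw [PeriodicNLS.isEven_iff] at he ⊢
    have h1 : (0 : ℝ) ≤ |t| + 1 := by positivity
    refine (((hsol u₀).reflH1.mono (Set.subset_univ _)).eqOn (T := |t| + 1)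
      ((hsol u₀).mono (Set.subset_univ _)) ?_) ⟨?_, ?_⟩
    · rw [h0, he]
    · linarith [neg_abs_le t]
    · linarith [le_abs_self t]
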